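/- Write $\mathbb I=[0,1]$ and $2=\{0<1\}$. A \emph{join doctrine} is a class $\Phi$ of posets such that: (i) the one-point poset is in $\Phi$; (ii) if a poset $\phi$ is the union of a set $S$ of subposets that all belong to $\Phi$, and $S$, ordered by inclusion, belongs to $\Phi$, then $\phi\in\Phi$; (iii) if $\phi\in\Phi$ and $f:\phi\to\psi$ is monotone with cofinal image, then $\psi\in\Phi$; (iv) every cofinal subposet of a member of $\Phi$ is in $\Phi$. For a poset $X$ let $\Phi(X)$ be the set of lower subsets of $X$ that belong to $\Phi$. A $\Phi$-join is a join of a subset belonging to $\Phi$; a $\Phi$-suplattice is a poset with all $\Phi$-joins; a $\Phi$-ideal in it is a lower subset closed under $\Phi$-joins. Dually, for a join doctrine $\Psi$, a $\Psi^{\mathrm{op}}$-meet is a meet of a subset whose opposite poset belongs to $\Psi$. Let $\Phi,\Psi$ be join doctrines such that $\Phi$ is \emph{sound, dual to the meet doctrine $\Psi^{\mathrm{op}}$}: (a) for all posets $X,Y$, all $\phi\in\Phi(Y)$, $\psi\in\Psi(X)$ and all monotone $F:X^{\mathrm{op}}\times Y\to 2$, $\bigwedge_{x\in\psi}\bigvee_{y\in\phi}F(x,y)=\bigvee_{y\in\phi}\bigwedge_{x\in\psi}F(x,y)$;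 and (b) for every $\Psi$-suplattice $X$, $\Phi(X)$ consists precisely of all $\Psi$-ideals in $X$. Assume also that $\omega\in\Phi$. A complete lattice $X$ is a \emph{$\Phi$-continuous lattice} if for each $x\in X$ there is $\phi\in\Phi(X)$ with $x\le\bigvee\phi$ such that $\phi\subseteq\phi'$ for every $\phi'\in\Phi(X)$ with $x\le\bigvee\phi'$. Morphisms of such lattices are the maps preserving arbitrary meets and $\Phi$-joins. Let $\mathbb U$ be the monoid of monotone surjections $\mathbb I\to\mathbb I$ under composition, ordered pointwise. A \emph{$\mathbb U$-poset} is a poset with an action of $\mathbb U$ that is monotone in both variables; a \emph{$\mathbb U$-$\Psi^{\mathrm{op}}$-inflattice} is a $\mathbb U$-poset with all $\Psi^{\mathrm{op}}$-meets such that each $u\in\mathbb U$ preserves them. Morphisms are the monotone, $\mathbb U$-equivariant, $\Psi^{\mathrm{op}}$-meet-preserving maps. In a $\mathbb U$-poset $A$, for $r\in\mathbb I$ write $a\le_r b$ if $u(a)\le v(b)$ for all $u,v\in\mathbb U$ with $u(\min(1,t+r))\le v(t)$ for all $t\in\mathbb I$; let $\rho(a,b)=\inf\{r\in\mathbb I: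 a\le_r b\}$ and $\mathrm{dist}(a,b)=\max(\rho(a,b),\rho(b,a))$. Then $A$ is \emph{complete} if it is Archimedean (if $a\le_r b$ for all $r>0$, then $a\le b$) and every $\mathrm{dist}$-Cauchy sequence converges. It is \emph{stackable} if for all $0<r<1$ and all $u,v\in\mathbb U$ restricting to order-isomorphisms $u:[0,r]\cong[0,1]$ and $v:[r,1]\cong[0,1]$: (1) $u(a)\le u(b)$ and $v(a)\le v(b)$ imply $a\le b$; and (2) whenever $a,b\in A$ satisfy $v'(b)\le u'(a)$ for all $u',v'\in\mathbb U$, there is $c\in A$ with $u(c)=a$ and $v(c)=b$. \textbf{Theorem.} For every $\Phi$-continuous lattice $X$, the set $\mathrm{Hom}(X,\mathbb I)$ of meet- and $\Phi$-join-preserving maps $X\to\mathbb I$, with the pointwise order and $\mathbb U$-action, is a complete stackable $\mathbb U$-$\Psi^{\mathrm{op}}$-inflattice; for every $\mathbb U$-$\Psi^{\mathrm{op}}$-inflattice $A$, the set $\mathrm{Hom}(A,\mathbb I)$ of monotone $\mathbb U$-equivariant $\Psi^{\mathrm{op}}$-meet-preserving maps $A\to\mathbb I$, with the pointwise order, is a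 $\Phi$-continuous lattice. The resulting contravariant functors $\mathrm{Hom}(-,\mathbb I)$ between $\Phi$-continuous lattices and complete stackable $\mathbb U$-$\Psi^{\mathrm{op}}$-inflattices form a dual adjunction whose unit and counit are the evaluation maps $A\to\mathrm{Hom}(\mathrm{Hom}(A,\mathbb I),\mathbb I)$, $a\mapsto(f\mapsto f(a))$, and $X\to\mathrm{Hom}(\mathrm{Hom}(X,\mathbb I),\mathbb I)$, $x\mapsto(f\mapsto f(x))$. This dual adjunction is a dual equivalence of categories: both evaluation maps are isomorphisms for all such $A$ and $X$. -/

import Mathlib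

open CategoryTheory Opposite

universe u v w

/-! ### Join doctrines -/

/-- A join doctrine: a class of (small) posets, closed under the four saturation conditions. -/
structure JoinDoctrine : Type (u + 1) where
  /-- membership of a poset in the class -/
  Mem : (α : Type u) → [PartialOrder α] → Prop
  mem_punit : Mem PUnit.{u + 1}
  /-- `α` is the union of a set `S` of subposets in the class, and `S`, ordered by inclusion,
  is in the class. -/
  mem_sUnion : ∀ (α : Type u) [PartialOrder α] (S : Set (Set α)),
    (∀ s ∈ S, Mem s) → Mem S → ⋃₀ S = Set.univ → Mem α
  /-- monotone images with cofinal range -/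
  mem_of_map : ∀ (α β : Type u) [PartialOrder α] [PartialOrder β] (f : α → β),
    Monotone f → (∀ b, ∃ a, b ≤ f a) → Mem α → Mem β
  /-- cofinal subposets -/
  mem_of_cofinal : ∀ (α : Type u) [PartialOrder α] (s : Set α),
    (∀ a, ∃ b ∈ s, a ≤ b) → Mem α → Mem s

namespace JoinDoctrine

/-- `Φ.Lower X` is the set of all lower subsets of `X` that belong to `Φ`
(the free `Φ`-suplattice on `X`). -/
def Lower (Φ : JoinDoctrine.{u}) (X : Type u) [PartialOrder X] : Set (Set X) :=
  {s | IsLowerSet s ∧ Φ.Mem s}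

/-- All `Φ`-joins exist in `X`. -/
def IsSuplattice (Φ : JoinDoctrine.{u}) (X : Type u) [PartialOrder X] : Prop :=
  ∀ s : Set X, Φ.Mem s → ∃ m, IsLUB s m

/-- A `Φ`-ideal: a lower set closed under the `Φ`-joins of `X`. -/
def IsIdeal (Φ : JoinDoctrine.{u}) {X : Type u} [PartialOrder X] (s : Set X) : Prop :=
  IsLowerSet s ∧ ∀ t : Set X, t ⊆ s → Φ.Mem t → ∀ m, IsLUB t m → m ∈ s

/-- `Ψᵒᵖ`-meets commute with `Φ`-joins in the two-element lattice: for monotone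
`F : Xᵒᵖ × Y → 2`, `φ ∈ Φ(Y)` and `ψ ∈ Ψ(X)`, we have
`⋀_{x ∈ ψ} ⋁_{y ∈ φ} F (x, y) = ⋁_{y ∈ φ} ⋀_{x ∈ ψ} F (x, y)`. -/
def MeetsCommute (Φ Ψ : JoinDoctrine.{u}) : Prop :=
  ∀ (X Y : Type u) [PartialOrder X] [PartialOrder Y],
    ∀ φ ∈ Φ.Lower Y, ∀ ψ ∈ Ψ.Lower X, ∀ F : X → Y → Prop,
      (∀ x x' y y', x' ≤ x → y ≤ y' → F x y → F x' y') →
        ((∀ x ∈ ψ, ∃ y ∈ φ, F x y) ↔ ∃ y ∈ φ, ∀ x ∈ ψ, F x y)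

/-- `Φ` is a sound join doctrine, dual to the meet doctrine `Ψᵒᵖ`: `Ψᵒᵖ`-meets commute with
`Φ`-joins in `2`, and in every `Ψ`-suplattice `X`, the lower sets that belong to `Φ` are precisely
the `Ψ`-ideals. -/
structure IsSoundDual (Φ Ψ : JoinDoctrine.{u}) : Prop where
  commute : MeetsCommute Φ Ψ
  lower_eq_ideals : ∀ (X : Type u) [PartialOrder X], Ψ.IsSuplattice X →
    Φ.Lower X = {s : Set X | Ψ.IsIdeal s}

/-- The class contains the ordinal `ω`. -/
def HasOmega (Φ : JoinDoctrine.{u}) : Prop := Φ.Mem (ULift.{u} ℕ)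

end JoinDoctrine

/-! ### `Φ`-continuous lattices -/

/-- The relation `x ≪ y` relative to `Φ` in a complete lattice. -/
def PhiWayBelow (Φ : JoinDoctrine.{u}) {X : Type u} [CompleteLattice X] (x y : X) : Prop :=
  ∀ s ∈ Φ.Lower X, y ≤ sSup s → x ∈ s

/-- A complete lattice is `Φ`-continuous if every `x` lies below the join of some `s ∈ Φ(X)` all of
whose elements are `≪ x`. -/
def IsPhiContinuous (Φ : JoinDoctrine.{u}) (X : Type u) [CompleteLattice X] : Prop :=
  ∀ x : X, ∃ s ∈ Φ.Lower X, (∀ y ∈ s, PhiWayBelow Φ y x) ∧ x ≤ sSup s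

/-- Maps between complete lattices preserving arbitrary meets and `Φ`-joins. -/
@[ext]
structure PhiHom (Φ : JoinDoctrine.{u}) (X : Type u) (Y : Type v)
    [CompleteLattice X] [CompleteLattice Y] where
  toFun : X → Y
  map_sInf : ∀ s : Set X, toFun (sInf s) = sInf (toFun '' s)
  map_sSup : ∀ s : Set X, Φ.Mem s → toFun (sSup s) = sSup (toFun '' s)

/-- A (bundled) `Φ`-continuous lattice. -/
structure PhiCtsLat (Φ : JoinDoctrine.{u}) : Type (u + 1) where
  carrier : Type u
  [lattice : CompleteLattice carrier]
  continuous : IsPhiContinuous Φ carrier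

attribute [instance] PhiCtsLat.lattice

namespace PhiHom

variable {Φ : JoinDoctrine.{u}}

theorem mono {X : Type u} {Y : Type v} [CompleteLattice X] [CompleteLattice Y]
    (f : PhiHom Φ X Y) : Monotone f.toFun := by
  intro a b hab
  have h := f.map_sInf {a, b}
  rw [sInf_pair, inf_eq_left.2 hab, Set.image_pair, sInf_pair] at h
  exact inf_eq_left.1 h.symm

end PhiHom

theorem JoinDoctrine.mem_image (Φ : JoinDoctrine.{u}) {X Y : Type u} [PartialOrder X]
    [PartialOrder Y] {f : X → Y} (hf : Monotone f) {s : Set X} (hs : Φ.Mem s) :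
    Φ.Mem (f '' s) := by
  refine Φ.mem_of_map s (f '' s) (fun x => ⟨f x.1, x.1, x.2, rfl⟩) (fun a b h => hf h) ?_ hs
  rintro ⟨_, x, hx, rfl⟩
  exact ⟨⟨x, hx⟩, le_rfl⟩

theorem JoinDoctrine.mem_univ (Φ : JoinDoctrine.{u}) {X : Type u} [PartialOrder X]
    (h : Φ.Mem X) : Φ.Mem (Set.univ : Set X) :=
  Φ.mem_of_cofinal X Set.univ (fun a => ⟨a, trivial, le_rfl⟩) h

/-- The identity. -/
def PhiHom.id (Φ : JoinDoctrine.{u}) (X : Type u) [CompleteLattice X] : PhiHom Φ X X where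
  toFun := fun x => x
  map_sInf s := by simp
  map_sSup s _ := by simp

/-- Composition. -/
def PhiHom.comp {Φ : JoinDoctrine.{u}} {X Y : Type u} {Z : Type v} [CompleteLattice X]
    [CompleteLattice Y] [CompleteLattice Z] (g : PhiHom Φ Y Z) (f : PhiHom Φ X Y) :
    PhiHom Φ X Z where
  toFun := fun x => g.toFun (f.toFun x)
  map_sInf s := by rw [f.map_sInf, g.map_sInf, Set.image_image]
  map_sSup s hs := by
    rw [f.map_sSup s hs, g.map_sSup _ (Φ.mem_image f.mono hs), Set.image_image]

/-- The category of `Φ`-continuous lattices, with meet- and `Φ`-join-preserving maps. -/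
instance PhiCtsLat.category (Φ : JoinDoctrine.{u}) : Category (PhiCtsLat Φ) where
  Hom X Y := PhiHom Φ X.carrier Y.carrier
  id X := PhiHom.id Φ X.carrier
  comp f g := PhiHom.comp g f

/-! ### The monoid `𝕌` and `𝕌`-posets -/

/-- The monoid of monotone surjections `[0,1] → [0,1]` (i.e., complete lattice homomorphisms),
under composition, ordered pointwise. -/
def UMon : Submonoid (unitInterval →o unitInterval) where
  carrier := {f | Function.Surjective f}
  one_mem' := fun x => ⟨x, rfl⟩
  mul_mem' := fun {_ _} hf hg => hf.comp hg

/-- A `𝕌`-poset: a poset with an action of `𝕌`, monotone in both variables. -/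
class UPoset (A : Type v) [PartialOrder A] extends MulAction UMon A where
  smul_le_smul : ∀ (p q : UMon) (a b : A), p ≤ q → a ≤ b → p • a ≤ q • b

/-- `𝕌` acts on `[0,1]` by application. -/
instance unitInterval.uPoset : UPoset unitInterval where
  smul p t := p.1 t
  one_smul _ := rfl
  mul_smul _ _ _ := rfl
  smul_le_smul _ q a _ hpq hab := (hpq a).trans (q.1.monotone hab)

/-- `s ∈ Ψᵒᵖ` for a subset `s` of a poset, i.e., the opposite of `s` belongs to `Ψ`. -/
def JoinDoctrine.OpMem (Ψ : JoinDoctrine.{u}) {A : Type u} [PartialOrder A] (s : Set A) : Prop :=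
  Ψ.Mem (↥s)ᵒᵈ

/-- A `𝕌`-`Ψᵒᵖ`-inflattice: a `𝕌`-poset with all `Ψᵒᵖ`-meets, which are preserved by the action of
each element of `𝕌`. -/
structure UInflattice (Ψ : JoinDoctrine.{u}) : Type (u + 1) where
  carrier : Type u
  [order : PartialOrder carrier]
  [action : UPoset carrier]
  exists_isGLB : ∀ s : Set carrier, Ψ.OpMem s → ∃ m, IsGLB s m
  smul_isGLB : ∀ (p : UMon) (s : Set carrier) (m : carrier), Ψ.OpMem s → IsGLB s m →
    IsGLB ((fun a => p • a) '' s) (p • m)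

attribute [instance] UInflattice.order UInflattice.action

/-- Monotone, `𝕌`-equivariant, `Ψᵒᵖ`-meet-preserving maps. -/
@[ext]
structure UHom (Ψ : JoinDoctrine.{u}) (A : Type u) (B : Type v) [PartialOrder A] [UPoset A]
    [PartialOrder B] [UPoset B] where
  toFun : A → B
  mono : Monotone toFun
  map_smul : ∀ (p : UMon) (a : A), toFun (p • a) = p • toFun a
  map_isGLB : ∀ (s : Set A) (m : A), Ψ.OpMem s → IsGLB s m → IsGLB (toFun '' s) (toFun m)

theorem JoinDoctrine.opMem_image (Ψ : JoinDoctrine.{u}) {X Y : Type u} [PartialOrder X]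
    [PartialOrder Y] {f : X → Y} (hf : Monotone f) {s : Set X} (hs : Ψ.OpMem s) :
    Ψ.OpMem (f '' s) := by
  refine Ψ.mem_of_map (↥s)ᵒᵈ (↥(f '' s))ᵒᵈ
    (fun x => OrderDual.toDual ⟨f (OrderDual.ofDual x).1, _, (OrderDual.ofDual x).2, rfl⟩)
    (fun a b h => hf h) ?_ hs
  intro b
  obtain ⟨x, hx, hxb⟩ := (OrderDual.ofDual b).2
  exact ⟨OrderDual.toDual ⟨x, hx⟩, hxb.le⟩

/-- The identity. -/
def UHom.id (Ψ : JoinDoctrine.{u}) (A : Type u) [PartialOrder A] [UPoset A] : UHom Ψ A A where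
  toFun := fun a => a
  mono := monotone_id
  map_smul _ _ := rfl
  map_isGLB s m _ h := by simpa using h

/-- Composition. -/
def UHom.comp {Ψ : JoinDoctrine.{u}} {A B : Type u} {C : Type v} [PartialOrder A] [UPoset A]
    [PartialOrder B] [UPoset B] [PartialOrder C] [UPoset C] (g : UHom Ψ B C) (f : UHom Ψ A B) :
    UHom Ψ A C where
  toFun := fun a => g.toFun (f.toFun a)
  mono := g.mono.comp f.mono
  map_smul p a := by rw [f.map_smul, g.map_smul]
  map_isGLB s m hs hm := by
    have := g.map_isGLB _ _ (Ψ.opMem_image f.mono hs) (f.map_isGLB s m hs hm)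
    rwa [Set.image_image] at this

/-- The category of `𝕌`-`Ψᵒᵖ`-inflattices. -/
instance UInflattice.category (Ψ : JoinDoctrine.{u}) : Category (UInflattice Ψ) where
  Hom A B := UHom Ψ A.carrier B.carrier
  id A := UHom.id Ψ A.carrier
  comp f g := UHom.comp g f

/-! ### Complete stackable `𝕌`-posets -/

section UPosetNotions

variable (A : Type v) [PartialOrder A] [UPoset A]

/-- Truncated addition on `[0,1]`. -/
noncomputable def truncAdd (s t : unitInterval) : unitInterval :=
  ⟨min 1 ((s : ℝ) + t), le_min zero_le_one (add_nonneg s.2.1 t.2.1), min_le_left _ _⟩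

variable {A} in
/-- The relation `a ≤_r b`. -/
def LeUpTo (r : unitInterval) (a b : A) : Prop :=
  ∀ p q : UMon, (∀ t, p.1 (truncAdd t r) ≤ q.1 t) → p • a ≤ q • b

variable {A} in
/-- The pseudoquasimetric `ρ`. -/
noncomputable def uRho (a b : A) : unitInterval := sInf {r | LeUpTo r a b}

variable {A} in
/-- The pseudometric `dist (a, b) = ρ (a, b) ∨ ρ (b, a)`. -/
noncomputable def uDist (a b : A) : unitInterval := uRho a b ⊔ uRho b a

/-- Archimedean `𝕌`-posets. -/
def UArchimedean : Prop :=
  ∀ a b : A, (∀ r : unitInterval, 0 < r → LeUpTo r a b) → a ≤ b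

/-- Complete `𝕌`-posets: Archimedean, and every Cauchy sequence for `dist` converges. -/
def UComplete : Prop :=
  UArchimedean A ∧ ∀ x : ℕ → A,
    (∀ ε : unitInterval, 0 < ε → ∃ N, ∀ m ≥ N, ∀ n ≥ N, uDist (x m) (x n) < ε) →
      ∃ a : A, ∀ ε : unitInterval, 0 < ε → ∃ N, ∀ n ≥ N, uDist (x n) a < ε

/-- `p ∈ 𝕌` restricts to an order-isomorphism `[r, s] ≅ [0,1]` (a monotone bijection between chains
is an order-isomorphism). -/
def RestrictsToIso (p : UMon) (r s : unitInterval) : Prop :=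
  Set.BijOn p.1 (Set.Icc r s) Set.univ

/-- Unstackable `𝕌`-posets. -/
def UUnstackable : Prop :=
  ∀ r : unitInterval, 0 < r → r < 1 → ∀ p q : UMon,
    RestrictsToIso p 0 r → RestrictsToIso q r 1 →
      ∀ a b : A, p • a ≤ p • b → q • a ≤ q • b → a ≤ b

/-- Stackable `𝕌`-posets. -/
def UStackable : Prop :=
  UUnstackable A ∧ ∀ r : unitInterval, 0 < r → r < 1 → ∀ p q : UMon,
    RestrictsToIso p 0 r → RestrictsToIso q r 1 →
      ∀ a b : A, (∀ p' q' : UMon, q' • b ≤ p' • a) → ∃ c : A, p • c = a ∧ q • c = b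

end UPosetNotions

/-- The property of being complete and stackable. -/
def isCompleteStackable (Ψ : JoinDoctrine.{u}) : ObjectProperty (UInflattice Ψ) :=
  fun A => UComplete A.carrier ∧ UStackable A.carrier

/-- The full subcategory of complete stackable `𝕌`-`Ψᵒᵖ`-inflattices. -/
abbrev CStUInflattice (Ψ : JoinDoctrine.{u}) := (isCompleteStackable Ψ).FullSubcategory

/-! ### Preservation of meets and joins in `[0,1]` -/

theorem UMon.map_sSup (p : UMon) (s : Set unitInterval) : p.1 (sSup s) = sSup (p.1 '' s) := by
  apply le_antisymm
  · by_contra! hlt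
    obtain ⟨t, ht1, ht2⟩ := exists_between hlt
    obtain ⟨y, rfl⟩ := p.2 t
    have hy : y < sSup s := by
      by_contra! h
      exact absurd (p.1.monotone h) (not_le.2 ht2)
    obtain ⟨x, hx, hyx⟩ := lt_sSup_iff.1 hy
    exact absurd ((p.1.monotone hyx.le).trans (le_sSup (Set.mem_image_of_mem _ hx)))
      (not_le.2 ht1)
  · apply sSup_le
    rintro _ ⟨x, hx, rfl⟩
    exact p.1.monotone (le_sSup hx)

theorem UMon.map_sInf (p : UMon) (s : Set unitInterval) : p.1 (sInf s) = sInf (p.1 '' s) := by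
  apply le_antisymm
  · apply le_sInf
    rintro _ ⟨x, hx, rfl⟩
    exact p.1.monotone (sInf_le hx)
  · by_contra! hlt
    obtain ⟨t, ht1, ht2⟩ := exists_between hlt
    obtain ⟨y, rfl⟩ := p.2 t
    have hy : sInf s < y := by
      by_contra! h
      exact absurd (p.1.monotone h) (not_le.2 ht1)
    obtain ⟨x, hx, hyx⟩ := sInf_lt_iff.1 hy
    exact absurd ((sInf_le (Set.mem_image_of_mem _ hx)).trans (p.1.monotone hyx.le))
      (not_le.2 ht2)

/-- `Ψᵒᵖ`-meets commute with `Φ`-joins in `[0,1]`. -/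
theorem JoinDoctrine.MeetsCommute.iInf_iSup {Φ Ψ : JoinDoctrine.{u}} (h : MeetsCommute Φ Ψ)
    {X Y : Type u} [PartialOrder X] [PartialOrder Y] (hX : Ψ.Mem X) (hY : Φ.Mem Y)
    (F : X → Y → unitInterval) (hF : ∀ x x' y y', x' ≤ x → y ≤ y' → F x y ≤ F x' y') :
    ⨅ x, ⨆ y, F x y = ⨆ y, ⨅ x, F x y := by
  apply le_antisymm
  · by_contra! hlt
    obtain ⟨t, ht1, ht2⟩ := exists_between hlt
    have key := (h X Y Set.univ ⟨isLowerSet_univ, Φ.mem_univ hY⟩ Set.univ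
      ⟨isLowerSet_univ, Ψ.mem_univ hX⟩ (fun x y => t ≤ F x y)
      (fun x x' y y' h1 h2 h3 => h3.trans (hF x x' y y' h1 h2))).1
      (fun x _ => by
        obtain ⟨y, hy⟩ := lt_iSup_iff.1 (ht2.trans_le (iInf_le _ x))
        exact ⟨y, trivial, hy.le⟩)
    obtain ⟨y, _, hy⟩ := key
    exact absurd ((le_iInf fun x => hy x trivial).trans (le_iSup (fun y => ⨅ x, F x y) y))
      (not_le.2 ht1)
  · exact iSup_iInf_le_iInf_iSup _

/-! ### The dual of a `Φ`-continuous lattice -/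

section DualOfLattice

variable {Φ Ψ : JoinDoctrine.{u}} {X : Type u} [CompleteLattice X]

/-- Pointwise order. -/
instance PhiHom.partialOrder : PartialOrder (PhiHom Φ X unitInterval) :=
  PartialOrder.lift PhiHom.toFun fun _ _ => PhiHom.ext

/-- `𝕌` acts on homomorphisms into `[0,1]` by composition. -/
instance PhiHom.uPoset : UPoset (PhiHom Φ X unitInterval) where
  smul p f :=
    { toFun := fun x => p • f.toFun x
      map_sInf := fun s => by
        change p.1 _ = _
        rw [f.map_sInf, UMon.map_sInf, Set.image_image]; rfl
      map_sSup := fun s hs => by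
        change p.1 _ = _
        rw [f.map_sSup s hs, UMon.map_sSup, Set.image_image]; rfl }
  one_smul _ := rfl
  mul_smul _ _ _ := rfl
  smul_le_smul p q f g hpq hfg := fun x => UPoset.smul_le_smul p q (f.toFun x) (g.toFun x) hpq (hfg x)

/-- The pointwise meet of a set of homomorphisms belonging to `Ψᵒᵖ`. -/
noncomputable def PhiHom.meet (h : JoinDoctrine.MeetsCommute Φ Ψ)
    (s : Set (PhiHom Φ X unitInterval)) (hs : Ψ.OpMem s) : PhiHom Φ X unitInterval where
  toFun := fun x => ⨅ f : s, f.1.toFun x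
  map_sInf t := by
    rw [sInf_image]
    simp only [PhiHom.map_sInf, sInf_image]
    rw [iInf_comm]
    exact iInf_congr fun x => iInf_comm
  map_sSup t ht := by
    rw [sSup_image']
    simp only [PhiHom.map_sSup _ t ht, sSup_image']
    exact h.iInf_iSup (X := (↥s)ᵒᵈ) (Y := t) hs ht
      (fun f x => (OrderDual.ofDual f).1.toFun x.1)
      (fun f f' x x' hf hx => (PhiHom.mono _ hx).trans (hf x'.1))

theorem PhiHom.isGLB_meet (h : JoinDoctrine.MeetsCommute Φ Ψ)
    (s : Set (PhiHom Φ X unitInterval)) (hs : Ψ.OpMem s) : IsGLB s (PhiHom.meet h s hs) :=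
  ⟨fun f hf x => iInf_le (fun f : s => f.1.toFun x) ⟨f, hf⟩,
    fun _ hg x => le_iInf fun f : s => hg f.2 x⟩

theorem PhiHom.isGLB_apply (h : JoinDoctrine.MeetsCommute Φ Ψ)
    {s : Set (PhiHom Φ X unitInterval)} (hs : Ψ.OpMem s) {m : PhiHom Φ X unitInterval}
    (hm : IsGLB s m) (x : X) : IsGLB ((fun f => f.toFun x) '' s) (m.toFun x) := by
  rw [hm.unique (PhiHom.isGLB_meet h s hs)]
  have : (PhiHom.meet h s hs).toFun x = sInf ((fun f => f.toFun x) '' s) := by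
    rw [sInf_image']; rfl
  rw [this]
  exact isGLB_sInf _

/-- The `𝕌`-`Ψᵒᵖ`-inflattice of homomorphisms from a `Φ`-continuous lattice into `[0,1]`. -/
def PhiCtsLat.dual (h : JoinDoctrine.MeetsCommute Φ Ψ) (X : PhiCtsLat Φ) : UInflattice Ψ where
  carrier := PhiHom Φ X.carrier unitInterval
  exists_isGLB s hs := ⟨_, PhiHom.isGLB_meet h s hs⟩
  smul_isGLB p s m hs hm := by
    refine ⟨?_, fun g hg x => ?_⟩
    · rintro _ ⟨f, hf, rfl⟩
      exact UPoset.smul_le_smul p p m f le_rfl (hm.1 hf)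
    · change g.toFun x ≤ p.1 (m.toFun x)
      rw [(PhiHom.isGLB_apply h hs hm x).sInf_eq.symm, UMon.map_sInf]
      apply le_sInf
      rintro _ ⟨_, ⟨f, hf, rfl⟩, rfl⟩
      exact hg ⟨f, hf, rfl⟩ x

end DualOfLattice

/-! ### The dual of a `𝕌`-`Ψᵒᵖ`-inflattice -/

section DualOfInflattice

variable {Φ Ψ : JoinDoctrine.{u}} {A : Type u} [PartialOrder A] [UPoset A]

/-- Pointwise order. -/
instance UHom.partialOrder : PartialOrder (UHom Ψ A unitInterval) :=
  PartialOrder.lift UHom.toFun fun _ _ => UHom.ext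

theorem UHom.map_isGLB_eq (f : UHom Ψ A unitInterval) {s : Set A} {m : A} (hs : Ψ.OpMem s)
    (hm : IsGLB s m) : f.toFun m = ⨅ a : s, f.toFun a.1 := by
  rw [← (f.map_isGLB s m hs hm).sInf_eq, sInf_image']

/-- Pointwise meets. -/
noncomputable instance UHom.infSet : InfSet (UHom Ψ A unitInterval) where
  sInf S :=
    { toFun := fun a => ⨅ f : S, f.1.toFun a
      mono := fun _ _ hab => iInf_mono fun f => f.1.mono hab
      map_smul := fun p a => by
        change _ = p.1 (sInf _)
        rw [UMon.map_sInf, ← Set.range_comp]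
        exact iInf_congr fun f => f.1.map_smul p a
      map_isGLB := fun s m hs hm => by
        have : (⨅ f : S, f.1.toFun m) = sInf ((fun a => ⨅ f : S, f.1.toFun a) '' s) := by
          rw [sInf_image', iInf_comm]
          exact iInf_congr fun f => f.1.map_isGLB_eq hs hm
        rw [this]
        exact isGLB_sInf _ }

theorem UHom.isGLB_sInf (S : Set (UHom Ψ A unitInterval)) : IsGLB S (sInf S) :=
  ⟨fun f hf a => iInf_le (fun f : S => f.1.toFun a) ⟨f, hf⟩,
    fun _ hg a => le_iInf fun f : S => hg f.2 a⟩

/-- The homomorphisms into `[0,1]` form a complete lattice, with pointwise order and meets. -/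
noncomputable instance UHom.completeLattice : CompleteLattice (UHom Ψ A unitInterval) :=
  completeLatticeOfInf _ UHom.isGLB_sInf

theorem UHom.sInf_apply (S : Set (UHom Ψ A unitInterval)) (a : A) :
    (sInf S).toFun a = sInf ((fun f => f.toFun a) '' S) := by
  rw [sInf_image']; rfl

/-- `Φ`-joins of homomorphisms into `[0,1]` are pointwise. -/
theorem UHom.sSup_apply (h : JoinDoctrine.MeetsCommute Φ Ψ) (S : Set (UHom Ψ A unitInterval))
    (hS : Φ.Mem S) (a : A) : (sSup S).toFun a = sSup ((fun f => f.toFun a) '' S) := by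
  let g : UHom Ψ A unitInterval :=
    { toFun := fun a => ⨆ f : S, f.1.toFun a
      mono := fun _ _ hab => iSup_mono fun f => f.1.mono hab
      map_smul := fun p a => by
        change _ = p.1 (sSup _)
        rw [UMon.map_sSup, ← Set.range_comp]
        exact iSup_congr fun f => f.1.map_smul p a
      map_isGLB := fun s m hs hm => by
        have : (⨆ f : S, f.1.toFun m) = sInf ((fun a => ⨆ f : S, f.1.toFun a) '' s) := by
          rw [sInf_image']
          refine (iSup_congr fun f => f.1.map_isGLB_eq hs hm).trans ?_
          exact (h.iInf_iSup (X := (↥s)ᵒᵈ) (Y := S) hs hS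
            (fun a f => f.1.toFun (OrderDual.ofDual a).1)
            (fun a a' f f' ha hf => (f.1.mono ha).trans (hf _))).symm
        rw [this]
        exact _root_.isGLB_sInf _ }
  have hg : IsLUB S g :=
    ⟨fun f hf a => le_iSup (fun f : S => f.1.toFun a) ⟨f, hf⟩,
      fun _ hk a => iSup_le fun f : S => hk f.2 a⟩
  rw [hg.sSup_eq, sSup_image']

theorem UHom.isPhiContinuous (h : JoinDoctrine.IsSoundDual Φ Ψ) :
    IsPhiContinuous Φ (UHom Ψ A unitInterval) := by
  intro f
  have hsup : Ψ.IsSuplattice (UHom Ψ A unitInterval) := fun s _ => ⟨sSup s, isLUB_sSup s⟩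
  have hmem : {g | PhiWayBelow Φ g f} ∈ Φ.Lower (UHom Ψ A unitInterval) := by
    rw [h.lower_eq_ideals _ hsup]
    refine ⟨fun g g' hle hg s hs hf => hs.1 hle (hg s hs hf), ?_⟩
    intro t ht hΨ m hm s hs hf
    have hs' := hs
    rw [h.lower_eq_ideals _ hsup] at hs'
    exact hs'.2 t (fun g hg => ht hg s hs hf) hΨ m hm
  refine ⟨_, hmem, fun g hg => hg, fun a => ?_⟩
  rw [UHom.sSup_apply h.commute _ hmem.2]
  by_contra! hlt
  obtain ⟨r, hr1, hr2⟩ := exists_between hlt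
  have hg : PhiWayBelow Φ (sInf {k : UHom Ψ A unitInterval | r ≤ k.toFun a}) f := by
    intro s hs hf
    have h1 : r < sSup ((fun f => f.toFun a) '' s) := by
      rw [← UHom.sSup_apply h.commute _ hs.2]
      exact hr2.trans_le (hf a)
    obtain ⟨_, ⟨k, hk, rfl⟩, hrk⟩ := lt_sSup_iff.1 h1
    exact hs.1 (sInf_le (show r ≤ k.toFun a from hrk.le)) hk
  have h2 : r ≤ (sInf {k : UHom Ψ A unitInterval | r ≤ k.toFun a}).toFun a := by
    rw [UHom.sInf_apply]
    apply le_sInf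
    rintro _ ⟨k, hk, rfl⟩
    exact hk
  have h3 : (sInf {k : UHom Ψ A unitInterval | r ≤ k.toFun a}).toFun a ≤
      sSup ((fun f : UHom Ψ A unitInterval => f.toFun a) '' {g | PhiWayBelow Φ g f}) :=
    le_sSup ⟨_, hg, rfl⟩
  exact absurd (h2.trans h3) (not_le.2 hr1)

/-- The `Φ`-continuous lattice of homomorphisms from a `𝕌`-`Ψᵒᵖ`-inflattice into `[0,1]`. -/
noncomputable def UInflattice.dual (h : JoinDoctrine.IsSoundDual Φ Ψ) (A : UInflattice Ψ) :
    PhiCtsLat Φ where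
  carrier := UHom Ψ A.carrier unitInterval
  continuous := UHom.isPhiContinuous h

end DualOfInflattice

/-! ### The dual adjunction -/

section Duality

variable {Φ Ψ : JoinDoctrine.{u}}

/-- The contravariant functor `Hom(-, [0,1])` on `Φ`-continuous lattices. -/
noncomputable def latticeDual (h : JoinDoctrine.IsSoundDual Φ Ψ) : (PhiCtsLat Φ)ᵒᵖ ⥤ UInflattice Ψ where
  obj X := X.unop.dual h.commute
  map {X Y} g := show UHom Ψ (PhiHom Φ X.unop.carrier unitInterval)
      (PhiHom Φ Y.unop.carrier unitInterval) from
    { toFun := fun f => PhiHom.comp f g.unop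
      mono := fun _ _ hff y => hff _
      map_smul := fun _ _ => rfl
      map_isGLB := fun s m hs hm => by
        refine ⟨?_, fun k hk y => ?_⟩
        · rintro _ ⟨f, hf, rfl⟩
          exact fun y => hm.1 hf _
        · apply (PhiHom.isGLB_apply h.commute hs hm (g.unop.toFun y)).2
          rintro _ ⟨f, hf, rfl⟩
          exact hk ⟨f, hf, rfl⟩ y }

/-- The contravariant functor `Hom(-, [0,1])` on `𝕌`-`Ψᵒᵖ`-inflattices. -/
noncomputable def inflatticeDual (h : JoinDoctrine.IsSoundDual Φ Ψ) :
    UInflattice Ψ ⥤ (PhiCtsLat Φ)ᵒᵖ where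
  obj A := op (A.dual h)
  map {A B} g := Quiver.Hom.op (X := B.dual h) (Y := A.dual h)
    (show PhiHom Φ (UHom Ψ B.carrier unitInterval) (UHom Ψ A.carrier unitInterval) from
    { toFun := fun f => UHom.comp f g
      map_sInf := fun S => by
        apply UHom.ext
        funext a
        rw [UHom.sInf_apply, Set.image_image]
        exact UHom.sInf_apply S _
      map_sSup := fun S hS => by
        apply UHom.ext
        funext a
        have hmono : Monotone fun f : UHom Ψ B.carrier unitInterval => UHom.comp f g :=
          fun f f' hff a => (show ∀ b, f.toFun b ≤ f'.toFun b from hff) (g.toFun a)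
        rw [UHom.sSup_apply h.commute _ (Φ.mem_image hmono hS), Set.image_image]
        exact UHom.sSup_apply h.commute S hS _ })

/-- The evaluation map `A → Hom(Hom(A, [0,1]), [0,1])`, `a ↦ (f ↦ f a)`. -/
noncomputable def inflatticeEval (h : JoinDoctrine.IsSoundDual Φ Ψ) (A : UInflattice Ψ) :
    A ⟶ (A.dual h).dual h.commute :=
  show UHom Ψ A.carrier (PhiHom Φ (UHom Ψ A.carrier unitInterval) unitInterval) from
  { toFun := fun a =>
      { toFun := fun f => f.toFun a
        map_sInf := fun S => UHom.sInf_apply S a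
        map_sSup := fun S hS => UHom.sSup_apply h.commute S hS a }
    mono := fun _ _ hab f => f.mono hab
    map_smul := fun p a => PhiHom.ext (funext fun f => f.map_smul p a)
    map_isGLB := fun s m hs hm => by
      refine ⟨?_, fun k hk f => ?_⟩
      · rintro _ ⟨a, ha, rfl⟩
        exact fun f => f.mono (hm.1 ha)
      · apply (f.map_isGLB s m hs hm).2
        rintro _ ⟨a, ha, rfl⟩
        exact hk ⟨a, ha, rfl⟩ f }

/-- The evaluation map `X → Hom(Hom(X, [0,1]), [0,1])`, `x ↦ (f ↦ f x)`. -/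
noncomputable def latticeEval (h : JoinDoctrine.IsSoundDual Φ Ψ) (X : PhiCtsLat Φ) :
    X ⟶ (X.dual h.commute).dual h :=
  show PhiHom Φ X.carrier (UHom Ψ (PhiHom Φ X.carrier unitInterval) unitInterval) from
  { toFun := fun x =>
      { toFun := fun f => f.toFun x
        mono := fun _ _ hff => hff x
        map_smul := fun _ _ => rfl
        map_isGLB := fun _ _ hs hm => PhiHom.isGLB_apply h.commute hs hm x }
    map_sInf := fun s => by
      apply UHom.ext
      funext f
      rw [UHom.sInf_apply, Set.image_image]
      exact f.map_sInf s
    map_sSup := fun s hs => by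
      apply UHom.ext
      funext f
      rw [UHom.sSup_apply h.commute _ (Φ.mem_image (fun _ _ hxy f => f.mono hxy) hs),
        Set.image_image]
      exact f.map_sSup s hs }

/-- The dual adjunction between `Φ`-continuous lattices and `𝕌`-`Ψᵒᵖ`-inflattices given by
homomorphisms into `[0,1]`; its unit and counit are the evaluation maps. -/
noncomputable def dualAdjunction (h : JoinDoctrine.IsSoundDual Φ Ψ) :
    inflatticeDual h ⊣ latticeDual h :=
  Adjunction.mkOfUnitCounit
    { unit := { app := fun A => inflatticeEval h A }
      counit := { app := fun X => (latticeEval h X.unop).op } }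

/-- Provided that duals of `Φ`-continuous lattices are complete and stackable, the functor
`Hom(-, [0,1])` from `Φ`-continuous lattices to complete stackable `𝕌`-`Ψᵒᵖ`-inflattices. -/
noncomputable abbrev latticeDualCSt (h : JoinDoctrine.IsSoundDual Φ Ψ)
    (hC : ∀ X, isCompleteStackable Ψ ((latticeDual h).obj X)) :
    (PhiCtsLat Φ)ᵒᵖ ⥤ CStUInflattice Ψ :=
  (isCompleteStackable Ψ).lift (latticeDual h) hC

/-- The functor `Hom(-, [0,1])` on complete stackable `𝕌`-`Ψᵒᵖ`-inflattices. -/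
noncomputable abbrev inflatticeDualCSt (h : JoinDoctrine.IsSoundDual Φ Ψ) :
    CStUInflattice Ψ ⥤ (PhiCtsLat Φ)ᵒᵖ :=
  (isCompleteStackable Ψ).ι ⋙ inflatticeDual h

/-- The dual adjunction, restricted to complete stackable `𝕌`-`Ψᵒᵖ`-inflattices. -/
noncomputable def dualAdjunctionCSt (h : JoinDoctrine.IsSoundDual Φ Ψ)
    (hC : ∀ X, isCompleteStackable Ψ ((latticeDual h).obj X)) :
    inflatticeDualCSt h ⊣ latticeDualCSt h hC :=
  Adjunction.mkOfUnitCounit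
    { unit := { app := fun A => ObjectProperty.homMk (inflatticeEval h A.obj) }
      counit := { app := fun X => (latticeEval h X.unop).op } }

end Duality

/-! ### Piecewise linear elements of `𝕌` -/

namespace UMon

/-! The adjunction is formal, so everything rests on both evaluation maps being bijective and
order-reflecting; inverses of such maps are automatically morphisms.

Lattice side. The relation `≪` interpolates, so a Urysohn construction along the dyadic rationals
separates points (`PhiHom.exists_of_wayBelow`). For surjectivity, write `f_*` for the left adjoint
of `f`. A homomorphism `F` on `Hom(X, 𝕀)` is recovered from its value-one filter as evaluation at
the join of the points `f_*(1)` with `F f = 1`. Soundness makes this a `Φ`-join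
(`UInflattice.preimage_one_mem`), and `ω ∈ Φ` allows `f_*(1)` to be approached by `f_*(t)` with `t <
1`.

Inflattice side. Each `c` in `A` generates a homomorphism `UInflattice.principalHom`. These
homomorphisms yield `p • a ≤ q • b` whenever `q` reaches `1` strictly before `p` leaves `0`.
Unstackability glues finitely many such inequalities into `a ≤_r b`, and the Archimedean property
lets `r` tend to `0` (`UInflattice.le_of_forall_le`). For surjectivity, a homomorphism `G` on
`Hom(A, 𝕀)` has approximate indicators of its level sets represented by elements of `A`
(`UInflattice.exists_indicator`). Stacking `2 ^ k` of them approximates `G` within `2 ^ (-k)`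
(`UInflattice.exists_approx`), and completeness supplies the limit.

That `Hom(X, 𝕀)` is itself complete and stackable is checked pointwise, using that uniform limits
and stacks of homomorphisms are homomorphisms. -/

theorem map_zero (p : UMon) : p.1 0 = 0 := by
  obtain ⟨t, ht⟩ := p.2 0
  exact le_antisymm ((p.1.monotone unitInterval.nonneg').trans ht.le) unitInterval.nonneg'

theorem map_one (p : UMon) : p.1 1 = 1 := by
  obtain ⟨t, ht⟩ := p.2 1
  exact le_antisymm unitInterval.le_one' (ht.ge.trans (p.1.monotone unitInterval.le_one'))

/-- Left of `m` the smaller map vanishes, right of `m` the larger one is `1`. The separation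
argument compares elements of `𝕌` through this criterion. -/
theorem le_of_apply {p q : UMon} {m : unitInterval} (hp : p.1 m = 0) (hq : q.1 m = 1) :
    p ≤ q := by
  intro t
  rcases le_total t m with h | h
  · exact ((p.1.monotone h).trans hp.le).trans unitInterval.nonneg'
  · exact unitInterval.le_one'.trans (hq.ge.trans (q.1.monotone h))

/-- The map which is `0` on `[0, a]`, `1` on `[b, 1]`, and affine on `[a, b]`. -/
noncomputable def ramp (a b : unitInterval) (h : a < b) : UMon :=
  ⟨⟨fun t => Set.projIcc 0 1 zero_le_one (((t : ℝ) - a) / (b - a)), fun s t hst => by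
    have hab : (0 : ℝ) < b - a := sub_pos.2 h
    have hst' : (s : ℝ) ≤ t := hst
    exact Set.monotone_projIcc _ (by gcongr)⟩, fun y => by
    have hab : (0 : ℝ) < b - a := sub_pos.2 h
    have hy0 := y.2.1
    have hy1 := y.2.2
    have ha0 := a.2.1
    have hb1 := b.2.2
    refine ⟨⟨a + (b - a) * y, by positivity, by nlinarith⟩, ?_⟩
    change Set.projIcc 0 1 zero_le_one (((a : ℝ) + (b - a) * y - a) / (b - a)) = y
    rw [show ((a : ℝ) + (b - a) * y - a) / (b - a) = y by field_simp; ring]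
    exact Set.projIcc_val _ y⟩

theorem coe_ramp {a b : unitInterval} (h : a < b) (t : unitInterval) :
    ((ramp a b h).1 t : ℝ) = max 0 (min 1 (((t : ℝ) - a) / (b - a))) :=
  Set.coe_projIcc 0 1 zero_le_one _

theorem ramp_of_le {a b : unitInterval} (h : a < b) {t : unitInterval} (ht : t ≤ a) :
    (ramp a b h).1 t = 0 := by
  have hab : (0 : ℝ) < b - a := sub_pos.2 h
  have ht' : (t : ℝ) ≤ a := ht
  exact Set.projIcc_of_le_left zero_le_one (div_nonpos_of_nonpos_of_nonneg (by linarith) hab.le)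

theorem ramp_of_ge {a b : unitInterval} (h : a < b) {t : unitInterval} (ht : b ≤ t) :
    (ramp a b h).1 t = 1 := by
  have hab : (0 : ℝ) < b - a := sub_pos.2 h
  have ht' : (b : ℝ) ≤ t := ht
  exact Set.projIcc_of_right_le zero_le_one ((one_le_div hab).2 (by linarith))

theorem coe_ramp_of_mem {a b : unitInterval} (h : a < b) {t : unitInterval} (h1 : a ≤ t)
    (h2 : t ≤ b) : ((ramp a b h).1 t : ℝ) = ((t : ℝ) - a) / (b - a) := by
  have hab : (0 : ℝ) < b - a := sub_pos.2 h
  have h1' : (a : ℝ) ≤ t := h1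
  have h2' : (t : ℝ) ≤ b := h2
  rw [coe_ramp, min_eq_right ((div_le_one hab).2 (by linarith)),
    max_eq_right (div_nonneg (by linarith) hab.le)]

theorem ramp_restrictsToIso {a b : unitInterval} (h : a < b) :
    RestrictsToIso (ramp a b h) a b := by
  have hab : (0 : ℝ) < b - a := sub_pos.2 h
  refine ⟨fun _ _ => trivial, fun s hs t ht hst => ?_, fun y _ => ?_⟩
  · have := congrArg (Subtype.val) hst
    rw [coe_ramp_of_mem h hs.1 hs.2, coe_ramp_of_mem h ht.1 ht.2,
      div_left_inj' hab.ne'] at this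
    exact Subtype.ext (by linarith)
  · obtain ⟨t, ht⟩ := (ramp a b h).2 y
    refine ⟨max a (min b t), ⟨le_max_left _ _, max_le h.le (min_le_left _ _)⟩, ?_⟩
    rw [(ramp a b h).1.monotone.map_max, (ramp a b h).1.monotone.map_min, ht, ramp_of_le h le_rfl,
      ramp_of_ge h le_rfl, min_eq_right unitInterval.le_one', max_eq_right unitInterval.nonneg']

theorem ramp_pos {a b : unitInterval} (h : a < b) {t : unitInterval} (ht : a < t) :
    0 < (ramp a b h).1 t := by
  have hab : (0 : ℝ) < b - a := sub_pos.2 h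
  have ht' : (a : ℝ) < t := ht
  change (0 : ℝ) < _
  rw [coe_ramp]
  exact lt_max_of_lt_right (lt_min one_pos (div_pos (by linarith) hab))

end UMon

namespace RestrictsToIso

theorem strictMonoOn {p : UMon} {r s : unitInterval} (h : RestrictsToIso p r s) :
    StrictMonoOn p.1 (Set.Icc r s) :=
  (p.1.monotone.monotoneOn _).strictMonoOn_of_injOn h.injOn

theorem apply_left {p : UMon} {r s : unitInterval} (h : RestrictsToIso p r s) : p.1 r = 0 := by
  obtain ⟨t, ht, hpt⟩ := h.surjOn (Set.mem_univ 0)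
  exact le_antisymm ((p.1.monotone ht.1).trans hpt.le) unitInterval.nonneg'

theorem apply_right {p : UMon} {r s : unitInterval} (h : RestrictsToIso p r s) : p.1 s = 1 := by
  obtain ⟨t, ht, hpt⟩ := h.surjOn (Set.mem_univ 1)
  exact le_antisymm unitInterval.le_one' (hpt.ge.trans (p.1.monotone ht.2))

end RestrictsToIso

/-! ### The relation `≤_r` -/

section LeUpTo

variable {A : Type v} [PartialOrder A] [UPoset A]

theorem coe_truncAdd (s t : unitInterval) : (truncAdd s t : ℝ) = min 1 ((s : ℝ) + t) := rfl

theorem LeUpTo.mono {r s : unitInterval} {a b : A} (h : LeUpTo r a b) (hrs : r ≤ s) :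
    LeUpTo s a b := fun p q hpq => h p q fun t => (p.1.monotone (by
      have : (r : ℝ) ≤ s := hrs
      change (truncAdd t r : ℝ) ≤ truncAdd t s
      rw [coe_truncAdd, coe_truncAdd]
      gcongr)).trans (hpq t)

theorem leUpTo_of_uRho_lt {r : unitInterval} {a b : A} (h : uRho a b < r) : LeUpTo r a b := by
  obtain ⟨s, hs, hsr⟩ := sInf_lt_iff.1 h
  exact LeUpTo.mono hs hsr.le

theorem uRho_le {r : unitInterval} {a b : A} (h : LeUpTo r a b) : uRho a b ≤ r := sInf_le h

theorem leUpTo_iff {r s t : unitInterval} : LeUpTo r s t ↔ (s : ℝ) ≤ t + r := by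
  constructor
  · intro h
    by_contra! hlt
    have hs1 := s.2.2
    have hr0 := r.2.1
    have ht0 := t.2.1
    -- Two parallel ramps, from `t + r` to `1` and from `t` to `1 - r`: the second is the first
    -- moved left by `r`, so the pair is admissible, yet it sends `s` above `0` and `t` to `0`.
    let c : unitInterval := ⟨t + r, by positivity, by linarith⟩
    let d : unitInterval := ⟨1 - r, by linarith, by linarith⟩
    have hc : c < 1 := show (t : ℝ) + r < 1 by linarith
    have hd : t < d := show (t : ℝ) < 1 - r by linarith
    have key : (UMon.ramp c 1 hc).1 s ≤ (UMon.ramp t d hd).1 t := by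
      refine h (UMon.ramp c 1 hc) (UMon.ramp t d hd) fun x => ?_
      change ((UMon.ramp c 1 hc).1 _ : ℝ) ≤ (UMon.ramp t d hd).1 x
      rw [UMon.coe_ramp, UMon.coe_ramp, coe_truncAdd]
      have e1 : ((1 : unitInterval) : ℝ) - c = d - t := by
        change (1 : ℝ) - (t + r) = 1 - r - t
        ring
      have hd' : (0 : ℝ) < d - t := sub_pos.2 hd
      rw [e1]
      have e2 : min 1 ((x : ℝ) + r) - c ≤ x - t := by
        change min 1 ((x : ℝ) + r) - (t + r) ≤ x - t
        linarith [min_le_right 1 ((x : ℝ) + r)]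
      gcongr
    rw [UMon.ramp_of_le hd le_rfl] at key
    exact absurd (UMon.ramp_pos hc (show c < s from hlt)) (not_lt.2 key)
  · intro h p q hpq
    refine (p.1.monotone ?_).trans (hpq t)
    change (s : ℝ) ≤ truncAdd t r
    rw [coe_truncAdd]
    exact le_min s.2.2 h

theorem UHom.leUpTo {Ψ : JoinDoctrine.{u}} {A : Type u} [PartialOrder A] [UPoset A]
    (f : UHom Ψ A unitInterval) {r : unitInterval} {a b : A} (h : LeUpTo r a b) :
    LeUpTo r (f.toFun a) (f.toFun b) := fun p q hpq => by
  rw [← f.map_smul, ← f.map_smul]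
  exact f.mono (h p q hpq)

end LeUpTo

/-! ### The way-below relation -/

namespace JoinDoctrine

variable {Φ : JoinDoctrine.{u}} {X : Type u}

theorem lowerClosure_mem_lower [PartialOrder X] {s : Set X} (hs : Φ.Mem s) :
    {x | ∃ y ∈ s, x ≤ y} ∈ Φ.Lower X := by
  refine ⟨fun a b hba ⟨y, hy, hay⟩ => ⟨y, hy, le_trans hba hay⟩, ?_⟩
  refine Φ.mem_of_map s _ (fun y => ⟨y.1, y.1, y.2, le_rfl⟩) (fun _ _ h => h) ?_ hs
  rintro ⟨x, y, hy, hxy⟩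
  exact ⟨⟨y, hy⟩, hxy⟩

theorem range_mem [PartialOrder X] (hω : Φ.HasOmega) {x : ℕ → X} (hx : Monotone x) :
    Φ.Mem (Set.range x) := by
  refine Φ.mem_of_map (ULift.{u} ℕ) _ (fun n => ⟨x n.down, n.down, rfl⟩)
    (fun a b h => hx h) ?_ hω
  rintro ⟨_, n, rfl⟩
  exact ⟨⟨n⟩, le_rfl⟩

theorem Iic_mem_lower [PartialOrder X] (x : X) : Set.Iic x ∈ Φ.Lower X :=
  ⟨isLowerSet_Iic x, Φ.mem_of_map PUnit.{u + 1} _ (fun _ => ⟨x, le_rfl⟩) (fun _ _ _ => le_rfl)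
    (fun b => ⟨PUnit.unit, b.2⟩) Φ.mem_punit⟩

end JoinDoctrine

namespace PhiWayBelow

variable {Φ : JoinDoctrine.{u}} {X : Type u} [CompleteLattice X]

theorem le {x y : X} (h : PhiWayBelow Φ x y) : x ≤ y :=
  h _ (JoinDoctrine.Iic_mem_lower y) (le_sSup (le_refl y))

theorem mono {x y z w : X} (h : PhiWayBelow Φ y z) (hxy : x ≤ y) (hzw : z ≤ w) :
    PhiWayBelow Φ x w := fun s hs hw => hs.1 hxy (h s hs (hzw.trans hw))

theorem exists_le {x y : X} (h : PhiWayBelow Φ x y) {s : Set X} (hs : Φ.Mem s)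
    (hy : y ≤ sSup s) : ∃ z ∈ s, x ≤ z :=
  h _ (JoinDoctrine.lowerClosure_mem_lower hs)
    (hy.trans (sSup_le_sSup fun z hz => ⟨z, hz, le_rfl⟩))

/-- If `s` witnesses continuity at `y`, the set `T` of all elements way below some member of `s`
still has join above `y`. The union axiom of a join doctrine puts `T` in `Φ`, so `x ∈ T`. -/
theorem exists_between (hX : IsPhiContinuous Φ X) {x y : X} (h : PhiWayBelow Φ x y) :
    ∃ z, PhiWayBelow Φ x z ∧ PhiWayBelow Φ z y := by
  obtain ⟨s, hs, hsy, hy⟩ := hX y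
  have hbelow : ∀ z : X, {w | PhiWayBelow Φ w z} ∈ Φ.Lower X ∧ z ≤ sSup {w | PhiWayBelow Φ w z} := by
    intro z
    obtain ⟨t, ht, htz, hz⟩ := hX z
    have : {w | PhiWayBelow Φ w z} = t := Set.Subset.antisymm (fun w hw => hw t ht hz) htz
    rw [this]
    exact ⟨ht, hz⟩
  let T : Set X := {w | ∃ z ∈ s, PhiWayBelow Φ w z}
  have hT : T ∈ Φ.Lower X := by
    refine ⟨fun a b hba ⟨z, hz, haz⟩ => ⟨z, hz, haz.mono hba le_rfl⟩, ?_⟩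
    let D : X → Set T := fun z => {w | PhiWayBelow Φ w.1 z}
    have hD : Monotone D := fun z z' hz w hw => PhiWayBelow.mono hw le_rfl hz
    refine Φ.mem_sUnion T (D '' s) ?_ (Φ.mem_image hD hs.2) ?_
    · rintro _ ⟨z, hz, rfl⟩
      refine Φ.mem_of_map _ _ (fun w : {w | PhiWayBelow Φ w z} => ⟨⟨w.1, z, hz, w.2⟩, w.2⟩)
        (fun _ _ h => h) ?_ (hbelow z).1.2
      rintro ⟨⟨w, _⟩, hw⟩
      exact ⟨⟨w, hw⟩, le_rfl⟩
    · refine Set.eq_univ_of_forall ?_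
      rintro ⟨w, z, hz, hw⟩
      exact ⟨_, ⟨z, hz, rfl⟩, hw⟩
  obtain ⟨z, hz, hxz⟩ := h T hT (hy.trans (sSup_le fun z hz =>
    (hbelow z).2.trans (sSup_le_sSup fun w hw => ⟨z, hz, hw⟩)))
  exact ⟨z, hxz, hsy z hz⟩

theorem exists_not_le (hX : IsPhiContinuous Φ X) {x y : X} (h : ¬ x ≤ y) :
    ∃ z, PhiWayBelow Φ z x ∧ ¬ z ≤ y := by
  by_contra! hc
  obtain ⟨s, -, hs, hx⟩ := hX x
  exact h (hx.trans (sSup_le fun z hz => hc z (hs z hz)))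

end PhiWayBelow

/-! ### Homomorphisms into the unit interval and their left adjoints -/

namespace PhiHom

variable {Φ : JoinDoctrine.{u}} {X : Type u} [CompleteLattice X]

/-- The left adjoint of a homomorphism. -/
def leftAdj (f : PhiHom Φ X unitInterval) (r : unitInterval) : X := sInf {x | r ≤ f.toFun x}

theorem leftAdj_le_iff (f : PhiHom Φ X unitInterval) {r : unitInterval} {x : X} :
    f.leftAdj r ≤ x ↔ r ≤ f.toFun x := by
  refine ⟨fun h => le_trans ?_ (f.mono h), fun h => sInf_le h⟩
  rw [leftAdj, f.map_sInf]
  apply le_sInf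
  rintro _ ⟨y, hy, rfl⟩
  exact hy

/-- Preservation of `Φ`-joins by `f`, read through the adjunction: in `[0,1]` a number strictly
below a join lies below one of the joined elements. -/
theorem leftAdj_wayBelow (f : PhiHom Φ X unitInterval) {r s : unitInterval} (h : r < s) :
    PhiWayBelow Φ (f.leftAdj r) (f.leftAdj s) := by
  intro t ht hs
  rw [leftAdj_le_iff, f.map_sSup t ht.2] at hs
  obtain ⟨_, ⟨x, hx, rfl⟩, hrx⟩ := lt_sSup_iff.1 (h.trans_le hs)
  exact ht.1 (f.leftAdj_le_iff.2 hrx.le) hx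

end PhiHom

/-! ### Dyadic interpolation -/

section Dyadic

theorem exists_dyadic_btwn {a b : ℝ} (ha : 0 ≤ a) (hab : a < b) :
    ∃ k i : ℕ, a < (i : ℝ) / 2 ^ k ∧ (i : ℝ) / 2 ^ k < b := by
  obtain ⟨k, hk⟩ := exists_pow_lt_of_lt_one (sub_pos.2 hab) (one_half_lt_one (α := ℝ))
  have h2 : (0 : ℝ) < 2 ^ k := by positivity
  refine ⟨k, ⌊a * 2 ^ k⌋₊ + 1, ?_, ?_⟩
  · rw [lt_div_iff₀ h2]
    exact_mod_cast Nat.lt_floor_add_one _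
  · rw [div_lt_iff₀ h2]
    have h3 := Nat.floor_le (mul_nonneg ha h2.le)
    have h4 : 1 < (b - a) * 2 ^ k := by
      rw [one_div_pow, div_lt_iff₀ h2] at hk
      exact hk
    push_cast
    linarith

variable {X : Type u}

/-- The `i`-th point of the `k`-th dyadic subdivision of a pair of points, where `m` chooses
intermediate points. -/
def dyadicChain (m : X → X → X) (x y : X) : ℕ → ℕ → X
  -- Only indices `i ≤ 2 ^ k` are meaningful at level `k`; this is why the comparison lemmas bound
  -- the larger index.
  | 0, i => if i = 0 then x else y
  | k + 1, i =>
    if i % 2 = 0 then dyadicChain m x y k (i / 2)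
    else m (dyadicChain m x y k (i / 2)) (dyadicChain m x y k (i / 2 + 1))

variable {m : X → X → X} {x y : X}

/-- The point depends only on the dyadic rational `i / 2 ^ k`, so two levels can be compared on a
common refinement. -/
theorem dyadicChain_mul_pow (k l i : ℕ) :
    dyadicChain m x y (k + l) (i * 2 ^ l) = dyadicChain m x y k i := by
  induction l with
  | zero => simp
  | succ l ih =>
    rw [← ih, ← add_assoc, dyadicChain, pow_succ, ← mul_assoc]
    simp

theorem dyadicChain_succ {R : X → X → Prop} (hm : ∀ a b, R a b → R a (m a b) ∧ R (m a b) b)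
    (hxy : R x y) (k i : ℕ) (hi : i < 2 ^ k) :
    R (dyadicChain m x y k i) (dyadicChain m x y k (i + 1)) := by
  induction k generalizing i with
  | zero =>
    obtain rfl : i = 0 := by simpa using hi
    simpa [dyadicChain] using hxy
  | succ k ih =>
    rw [pow_succ] at hi
    have h := hm _ _ (ih (i / 2) (by omega))
    rcases Nat.mod_two_eq_zero_or_one i with h0 | h1
    · have e : (i + 1) / 2 = i / 2 := by omega
      have e' : ¬ (i + 1) % 2 = 0 := by omega
      simp only [dyadicChain, h0, if_true, e, e', if_false]
      exact h.1
    · have e : (i + 1) / 2 = i / 2 + 1 := by omega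
      have e' : (i + 1) % 2 = 0 := by omega
      simp only [dyadicChain, h1, one_ne_zero, if_true, e, e', if_false]
      exact h.2

theorem dyadicChain_lt {R : X → X → Prop} (hR : ∀ a b c, R a b → R b c → R a c)
    (hm : ∀ a b, R a b → R a (m a b) ∧ R (m a b) b)
    (hxy : R x y) (k : ℕ) {i j : ℕ} (hij : i < j) (hj : j ≤ 2 ^ k) :
    R (dyadicChain m x y k i) (dyadicChain m x y k j) := by
  induction j, hij using Nat.le_induction with
  | base => exact dyadicChain_succ hm hxy k i (by omega)
  | succ j hij ih => exact hR _ _ _ (ih (by omega)) (dyadicChain_succ hm hxy k j (by omega))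

theorem dyadicChain_div_lt {R : X → X → Prop} (hR : ∀ a b c, R a b → R b c → R a c)
    (hm : ∀ a b, R a b → R a (m a b) ∧ R (m a b) b)
    (hxy : R x y) {k l i j : ℕ} (hij : (i : ℝ) / 2 ^ k < (j : ℝ) / 2 ^ l) (hj : j ≤ 2 ^ l) :
    R (dyadicChain m x y k i) (dyadicChain m x y l j) := by
  rw [← dyadicChain_mul_pow k l i, ← dyadicChain_mul_pow l k j, add_comm l k]
  refine dyadicChain_lt hR hm hxy _ ?_ ?_
  · rw [div_lt_div_iff₀ (by positivity) (by positivity)] at hij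
    exact_mod_cast hij
  · rw [pow_add, mul_comm (2 ^ k)]
    exact Nat.mul_le_mul_right _ hj

end Dyadic

/-! ### Urysohn's lemma for `≪`, and separation of points of a `Φ`-continuous lattice. -/

namespace PhiHom

variable {Φ : JoinDoctrine.{u}} {X : Type u} [CompleteLattice X]

/-- A form of Urysohn's lemma. -/
theorem exists_of_wayBelow (hX : IsPhiContinuous Φ X) {x y : X} (hxy : PhiWayBelow Φ x y) :
    ∃ f : PhiHom Φ X unitInterval, f.toFun y = 1 ∧ ∀ w, 0 < f.toFun w → x ≤ w := by
  have hint : ∀ a b : X, ∃ c, PhiWayBelow Φ a b → PhiWayBelow Φ a c ∧ PhiWayBelow Φ c b := by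
    intro a b
    by_cases h : PhiWayBelow Φ a b
    · obtain ⟨c, hc⟩ := h.exists_between hX
      exact ⟨c, fun _ => hc⟩
    · exact ⟨a, fun h' => absurd h' h⟩
  choose m hm using hint
  let z := dyadicChain m x y
  have hz : ∀ {k l i j : ℕ}, (i : ℝ) / 2 ^ k < (j : ℝ) / 2 ^ l → (j : ℝ) / 2 ^ l ≤ 1 →
      PhiWayBelow Φ (z k i) (z l j) := fun {k l i j} hij hj =>
    dyadicChain_div_lt (fun a b c h1 h2 => h1.mono le_rfl h2.le) hm hxy hij
      (by rw [div_le_one (by positivity)] at hj; exact_mod_cast hj)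
  let S : X → Set unitInterval := fun w => {t | ∃ k i : ℕ, z k i ≤ w ∧ (t : ℝ) = (i : ℝ) / 2 ^ k}
  -- The points `z k i` form a `≪`-increasing family indexed by the dyadic rationals in `[0,1]`,
  -- from `x` to `y`; `f w` is the supremum of the indices whose point lies below `w`.
  let f : X → unitInterval := fun w => sSup (S w)
  have hS : Monotone f := fun w w' hw =>
    sSup_le_sSup fun t ⟨k, i, h1, h2⟩ => ⟨k, i, h1.trans hw, h2⟩
  have hdy : ∀ {s t : unitInterval}, s < t → ∃ d : unitInterval, s < d ∧ d < t ∧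
      ∃ k i : ℕ, (d : ℝ) = (i : ℝ) / 2 ^ k := by
    intro s t hst
    obtain ⟨k, i, h1, h2⟩ := exists_dyadic_btwn s.2.1 (show (s : ℝ) < t from hst)
    exact ⟨⟨(i : ℝ) / 2 ^ k, by positivity, h2.le.trans t.2.2⟩, h1, h2, k, i, rfl⟩
  have hlt : ∀ {w : X} {d : unitInterval} {k i : ℕ}, d < f w → (d : ℝ) = (i : ℝ) / 2 ^ k →
      z k i ≤ w := by
    intro w d k i hd hdi
    obtain ⟨t, ⟨l, j, hj, ht⟩, hdt⟩ := lt_sSup_iff.1 hd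
    have hdt' : (d : ℝ) < t := hdt
    rw [hdi, ht] at hdt'
    exact (hz hdt' (ht ▸ t.2.2)).le.trans hj
  refine ⟨⟨f, fun s => ?_, fun s hs => ?_⟩, ?_, ?_⟩
  · apply le_antisymm
    · apply le_sInf
      rintro _ ⟨w, hw, rfl⟩
      exact hS (sInf_le hw)
    · by_contra! hc
      obtain ⟨d, hd1, hd2, k, i, hd⟩ := hdy hc
      refine absurd (le_sSup (show d ∈ S (sInf s) from ⟨k, i, le_sInf fun w hw => ?_, hd⟩))
        (not_le.2 hd1)
      exact hlt (hd2.trans_le (sInf_le ⟨w, hw, rfl⟩)) hd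
  · apply le_antisymm
    · by_contra! hc
      -- Two dyadic levels `d < d'` are needed: the point at `d'` lies below the join, and the point
      -- at `d`, being way below it, lies below a single member of `s`.
      obtain ⟨d', hd'1, hd'2, k', i', hd'⟩ := hdy hc
      obtain ⟨d, hd1, hd2, k, i, hd⟩ := hdy hd'1
      have hdd : (d : ℝ) < d' := hd2
      rw [hd, hd'] at hdd
      obtain ⟨w, hw, hzw⟩ := (hz hdd (hd' ▸ d'.2.2)).exists_le hs (hlt hd'2 hd')
      exact absurd ((le_sSup (show d ∈ S w from ⟨k, i, hzw, hd⟩)).trans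
        (le_sSup (Set.mem_image_of_mem f hw))) (not_le.2 hd1)
    · apply sSup_le
      rintro _ ⟨w, hw, rfl⟩
      exact hS (le_sSup hw)
  · refine le_antisymm unitInterval.le_one' (le_sSup ⟨0, 1, ?_, by simp⟩)
    simp [z, dyadicChain]
  · intro w hw
    have h0 : z 0 0 ≤ w := hlt (d := 0) hw (by simp)
    simpa [z, dyadicChain] using h0

theorem le_of_forall_apply_le (hX : IsPhiContinuous Φ X) {x y : X}
    (h : ∀ f : PhiHom Φ X unitInterval, f.toFun x ≤ f.toFun y) : x ≤ y := by
  by_contra hxy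
  obtain ⟨z, hzx, hzy⟩ := PhiWayBelow.exists_not_le hX hxy
  obtain ⟨f, hf1, hf0⟩ := exists_of_wayBelow hX hzx
  exact hzy (hf0 y (one_pos.trans_le (hf1.ge.trans (h f))))

end PhiHom

theorem UMon.le_of_ramp_eq_one {a b : unitInterval} (h : a < b) {t : unitInterval}
    (ht : (UMon.ramp a b h).1 t = 1) : b ≤ t := by
  by_contra! hlt
  have hr := UMon.ramp_restrictsToIso h
  rcases le_total t a with hta | hta
  · rw [UMon.ramp_of_le h hta] at ht
    exact zero_ne_one ht
  · have := hr.strictMonoOn ⟨hta, hlt.le⟩ ⟨h.le, le_rfl⟩ hlt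
    rw [ht, hr.apply_right] at this
    exact lt_irrefl _ this

/-! ### Evaluation on a `Φ`-continuous lattice is bijective -/

section LatticeEval

variable {Φ Ψ : JoinDoctrine.{u}}

/-- The value-one filter is closed upwards and under `Ψᵒᵖ`-meets, so it is a `Ψ`-ideal of the
opposite poset, and soundness applies. Both surjectivity proofs take joins indexed by this set. -/
theorem UInflattice.preimage_one_mem (h : JoinDoctrine.IsSoundDual Φ Ψ) (A : UInflattice Ψ)
    (f : UHom Ψ A.carrier unitInterval) :
    Φ.Mem {a : A.carrierᵒᵈ | f.toFun (OrderDual.ofDual a) = 1} := by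
  suffices hs : {a : A.carrierᵒᵈ | f.toFun (OrderDual.ofDual a) = 1} ∈ Φ.Lower A.carrierᵒᵈ from hs.2
  rw [h.lower_eq_ideals]
  · refine ⟨fun a b hba ha => le_antisymm unitInterval.le_one' (ha.ge.trans (f.mono hba)), ?_⟩
    intro t ht hΨ m hm
    refine le_antisymm unitInterval.le_one' ((f.map_isGLB (A := A.carrier) t m hΨ hm).2 ?_)
    rintro _ ⟨a, ha, rfl⟩
    exact (ht ha).ge
  · exact fun s hs => A.exists_isGLB (fun a => s a) hs

variable {X : Type u} [CompleteLattice X]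

/-- This is where `ω ∈ Φ` enters: `f` preserves the join of the increasing sequence `f.leftAdj (1 -
1 / (n + 1))`, so that join lies above `f.leftAdj 1`. -/
theorem PhiHom.exists_lt_one_of_wayBelow (hω : Φ.HasOmega) (f : PhiHom Φ X unitInterval) {x : X}
    (hx : PhiWayBelow Φ x (f.leftAdj 1)) : ∃ t < 1, x ≤ f.leftAdj t := by
  let t : ℕ → unitInterval := fun n => unitInterval.symm ⟨1 / ((n : ℝ) + 1),
    by positivity, by rw [div_le_one (by positivity)]; linarith [n.cast_nonneg (α := ℝ)]⟩
  have ht : ∀ n, (t n : ℝ) = 1 - 1 / ((n : ℝ) + 1) := fun n => rfl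
  have ht1 : ∀ n, t n < 1 := fun n => by
    change (t n : ℝ) < 1
    rw [ht]
    have : (0 : ℝ) < 1 / ((n : ℝ) + 1) := by positivity
    linarith
  have hmono : Monotone fun n => f.leftAdj (t n) := by
    intro n n' hn
    refine f.leftAdj_le_iff.2 (le_trans ?_ (f.leftAdj_le_iff.1 le_rfl))
    change (t n : ℝ) ≤ t n'
    rw [ht, ht]
    have : (n : ℝ) ≤ n' := by exact_mod_cast hn
    gcongr
  obtain ⟨_, ⟨n, rfl⟩, hn⟩ := hx.exists_le (JoinDoctrine.range_mem hω hmono) (by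
    rw [f.leftAdj_le_iff]
    by_contra! hlt
    have hlt' : ((f.toFun (sSup (Set.range fun n => f.leftAdj (t n))) : unitInterval) : ℝ) < 1 := hlt
    obtain ⟨n, hn⟩ := exists_nat_one_div_lt (sub_pos.2 hlt')
    have : t n ≤ f.toFun (sSup (Set.range fun n => f.leftAdj (t n))) :=
      f.leftAdj_le_iff.1 (le_sSup ⟨n, rfl⟩)
    have this' : (t n : ℝ) ≤ f.toFun (sSup (Set.range fun n => f.leftAdj (t n))) := this
    rw [ht] at this'
    linarith)
  exact ⟨t n, ht1 n, hn⟩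

theorem PhiHom.exists_eval_eq (h : JoinDoctrine.IsSoundDual Φ Ψ) (hω : Φ.HasOmega)
    (X : PhiCtsLat Φ) (F : UHom Ψ (PhiHom Φ X.carrier unitInterval) unitInterval) :
    ∃ x : X.carrier, ∀ g, F.toFun g = g.toFun x := by
  let D := {f : (PhiHom Φ X.carrier unitInterval)ᵒᵈ | F.toFun (OrderDual.ofDual f) = 1}
  have hD : Φ.Mem D := UInflattice.preimage_one_mem h (X.dual h.commute) F
  let e : (PhiHom Φ X.carrier unitInterval)ᵒᵈ → X.carrier := fun f => (OrderDual.ofDual f).leftAdj 1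
  have he : Monotone e := fun f f' hf => (OrderDual.ofDual f).leftAdj_le_iff.2
    (((OrderDual.ofDual f').leftAdj_le_iff.1 le_rfl).trans (hf _))
  -- If `F` is evaluation at `x`, then `F f = 1` means `f.leftAdj 1 ≤ x`; this suggests the join as
  -- the candidate.
  refine ⟨sSup (e '' D), fun g => ?_⟩
  apply le_antisymm
  · rcases eq_or_lt_of_le (unitInterval.nonneg' (t := F.toFun g)) with h0 | h0
    · exact h0 ▸ unitInterval.nonneg'
    · let f := UMon.ramp 0 _ h0 • g
      have hf : F.toFun f = 1 := (F.map_smul _ g).trans (UMon.ramp_of_ge h0 le_rfl)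
      refine le_trans ?_ (g.mono (le_sSup ⟨OrderDual.toDual f, hf, rfl⟩))
      exact UMon.le_of_ramp_eq_one h0
        (le_antisymm unitInterval.le_one' (f.leftAdj_le_iff.1 (le_refl (f.leftAdj 1))))
  · rw [g.map_sSup _ (Φ.mem_image he hD)]
    apply sSup_le
    rintro _ ⟨_, ⟨f, hf, rfl⟩, rfl⟩
    by_contra! hlt
    obtain ⟨s, hs1, hs2⟩ := exists_between hlt
    obtain ⟨r, hr1, hr2⟩ := exists_between hs1
    obtain ⟨t, ht1, ht⟩ := PhiHom.exists_lt_one_of_wayBelow hω (OrderDual.ofDual f)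
      ((g.leftAdj_wayBelow hs2).mono le_rfl (g.leftAdj_le_iff.2 le_rfl))
    -- Wherever `f` is at least `t`, `g` is at least `s`. Applying `F` to the resulting inequality
    -- gives `1 ≤ 0`, because `F f = 1` while `F g < r`.
    have hle : UMon.ramp t 1 ht1 • OrderDual.ofDual f ≤ UMon.ramp r s hr2 • g := by
      intro w
      change (UMon.ramp t 1 ht1).1 ((OrderDual.ofDual f).toFun w) ≤
        (UMon.ramp r s hr2).1 (g.toFun w)
      rcases le_total ((OrderDual.ofDual f).toFun w) t with hw | hw
      · rw [UMon.ramp_of_le ht1 hw]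
        exact unitInterval.nonneg'
      · rw [UMon.ramp_of_ge hr2 (g.leftAdj_le_iff.1 (ht.trans (PhiHom.leftAdj_le_iff _ |>.2 hw)))]
        exact unitInterval.le_one'
    have hle' := F.mono hle
    rw [F.map_smul, F.map_smul] at hle'
    change (UMon.ramp t 1 ht1).1 (F.toFun (OrderDual.ofDual f)) ≤
      (UMon.ramp r s hr2).1 (F.toFun g) at hle'
    rw [UMon.ramp_of_le hr2 hr1.le, UMon.ramp_of_ge ht1 hf.ge] at hle'
    exact absurd hle' (not_le.2 one_pos)

end LatticeEval

/-! ### The dual of a `Φ`-continuous lattice is complete and stackable -/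

namespace PhiHom

variable {Φ : JoinDoctrine.{u}} {X : Type u} [CompleteLattice X]

theorem leUpTo_iff {r : unitInterval} {f g : PhiHom Φ X unitInterval} :
    LeUpTo r f g ↔ ∀ x, (f.toFun x : ℝ) ≤ g.toFun x + r :=
  ⟨fun h x => _root_.leUpTo_iff.1 fun p q hpq => h p q hpq x,
    fun h p q hpq x => _root_.leUpTo_iff.2 (h x) p q hpq⟩

theorem abs_sub_le_of_uDist_lt {r : unitInterval} {f g : PhiHom Φ X unitInterval}
    (h : uDist f g < r) (x : X) : |(f.toFun x : ℝ) - g.toFun x| ≤ r := by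
  have h1 := leUpTo_iff.1 (leUpTo_of_uRho_lt (le_sup_left.trans_lt h)) x
  have h2 := leUpTo_iff.1 (leUpTo_of_uRho_lt (le_sup_right.trans_lt h)) x
  exact abs_sub_le_iff.2 ⟨by linarith, by linarith⟩

/-- An approximant with error below both `t - c` and `d - t` detects the gap in `l`. Each
preservation property of the limit thereby reduces to that of one homomorphism. -/
theorem exists_separating {l : X → unitInterval}
    (H : ∀ ε : ℝ, 0 < ε → ∃ f : PhiHom Φ X unitInterval, ∀ x, |(f.toFun x : ℝ) - l x| < ε)
    {c d : unitInterval} (h : c < d) : ∃ (t : unitInterval) (f : PhiHom Φ X unitInterval),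
      ∀ w, (d ≤ l w → t < f.toFun w) ∧ (l w ≤ c → f.toFun w < t) := by
  obtain ⟨t, h1, h2⟩ := exists_between h
  have h1' : (c : ℝ) < t := h1
  have h2' : (t : ℝ) < d := h2
  obtain ⟨f, hf⟩ := H (min (t - c) (d - t)) (lt_min (by linarith) (by linarith))
  have h4 := min_le_left ((t : ℝ) - c) (d - t)
  have h5 := min_le_right ((t : ℝ) - c) (d - t)
  refine ⟨t, f, fun w => ⟨fun hw => ?_, fun hw => ?_⟩⟩
  · have hw' : (d : ℝ) ≤ l w := hw
    change (t : ℝ) < f.toFun w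
    linarith [(abs_lt.1 (hf w)).1]
  · have hw' : (l w : ℝ) ≤ c := hw
    change (f.toFun w : ℝ) < t
    linarith [(abs_lt.1 (hf w)).2]

theorem monotone_of_uniformLimit {l : X → unitInterval}
    (H : ∀ ε : ℝ, 0 < ε → ∃ f : PhiHom Φ X unitInterval, ∀ x, |(f.toFun x : ℝ) - l x| < ε) :
    Monotone l := by
  intro x y hxy
  by_contra! hlt
  obtain ⟨t, f, hf⟩ := exists_separating H hlt
  exact absurd (f.mono hxy) (not_le.2 (((hf y).2 le_rfl).trans ((hf x).1 le_rfl)))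

/-- A uniform limit of homomorphisms. -/
def ofUniformLimit (l : X → unitInterval)
    (H : ∀ ε : ℝ, 0 < ε → ∃ f : PhiHom Φ X unitInterval, ∀ x, |(f.toFun x : ℝ) - l x| < ε) :
    PhiHom Φ X unitInterval where
  toFun := l
  map_sInf s := by
    apply le_antisymm
    · apply le_sInf
      rintro _ ⟨x, hx, rfl⟩
      exact monotone_of_uniformLimit H (sInf_le hx)
    · by_contra! hlt
      obtain ⟨t, f, hf⟩ := exists_separating H hlt
      refine absurd ((hf _).2 le_rfl) (not_lt.2 ?_)
      rw [f.map_sInf]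
      apply le_sInf
      rintro _ ⟨x, hx, rfl⟩
      exact ((hf x).1 (sInf_le ⟨x, hx, rfl⟩)).le
  map_sSup s hs := by
    apply le_antisymm
    · by_contra! hlt
      obtain ⟨t, f, hf⟩ := exists_separating H hlt
      refine absurd ((hf _).1 le_rfl) (not_lt.2 ?_)
      rw [f.map_sSup s hs]
      apply sSup_le
      rintro _ ⟨x, hx, rfl⟩
      exact ((hf x).2 (le_sSup ⟨x, hx, rfl⟩)).le
    · apply sSup_le
      rintro _ ⟨x, hx, rfl⟩
      exact monotone_of_uniformLimit H (le_sSup hx)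

theorem uComplete : UComplete (PhiHom Φ X unitInterval) := by
  refine ⟨fun f g hfg x => ?_, fun f hf => ?_⟩
  · change (f.toFun x : ℝ) ≤ g.toFun x
    refine le_of_forall_pos_le_add fun ε hε => ?_
    have h := leUpTo_iff.1 (hfg ⟨min 1 ε, by positivity, min_le_left _ _⟩
      (show (0 : ℝ) < min 1 ε by positivity)) x
    exact h.trans (by gcongr; exact min_le_right 1 ε)
  · have hC : ∀ ε : ℝ, 0 < ε → ∃ N, ∀ m ≥ N, ∀ n ≥ N, ∀ x,
        |((f m).toFun x : ℝ) - (f n).toFun x| ≤ ε := by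
      intro ε hε
      obtain ⟨N, hN⟩ := hf ⟨min 1 ε, by positivity, min_le_left _ _⟩
        (show (0 : ℝ) < min 1 ε by positivity)
      exact ⟨N, fun m hm n hn x => (abs_sub_le_of_uDist_lt (hN m hm n hn) x).trans
        (min_le_right 1 ε)⟩
    have hlim : ∀ x, ∃ l : unitInterval, Filter.Tendsto (fun n => (f n).toFun x) Filter.atTop
        (nhds l) := by
      intro x
      apply cauchySeq_tendsto_of_complete
      refine Metric.cauchySeq_iff.2 fun ε hε => ?_
      obtain ⟨N, hN⟩ := hC (ε / 2) (by positivity)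
      exact ⟨N, fun m hm n hn => (hN m hm n hn x).trans_lt (by linarith)⟩
    choose l hl using hlim
    have hU : ∀ ε : ℝ, 0 < ε → ∃ N, ∀ n ≥ N, ∀ x, |((f n).toFun x : ℝ) - l x| ≤ ε := by
      intro ε hε
      obtain ⟨N, hN⟩ := hC ε hε
      refine ⟨N, fun n hn x => ?_⟩
      refine le_of_tendsto (x := Filter.atTop) (f := fun m => |((f n).toFun x : ℝ) - (f m).toFun x|)
        ?_ (Filter.eventually_atTop.2 ⟨N, fun m hm => hN n hn m hm x⟩)
      exact (((continuous_subtype_val.tendsto _).comp (hl x)).const_sub _).abs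
    refine ⟨ofUniformLimit l fun ε hε => ?_, fun ε hε => ?_⟩
    · obtain ⟨N, hN⟩ := hU (ε / 2) (by positivity)
      exact ⟨f N, fun x => (hN N le_rfl x).trans_lt (by linarith)⟩
    · obtain ⟨δ, hδ0, hδ⟩ := exists_between hε
      obtain ⟨N, hN⟩ := hU δ hδ0
      refine ⟨N, fun n hn => (sup_le (uRho_le ?_) (uRho_le ?_)).trans_lt hδ⟩
      · refine leUpTo_iff.2 fun x => ?_
        change ((f n).toFun x : ℝ) ≤ l x + δ
        linarith [(abs_le.1 (hN n hn x)).2]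
      · refine leUpTo_iff.2 fun x => ?_
        change (l x : ℝ) ≤ (f n).toFun x + δ
        linarith [(abs_le.1 (hN n hn x)).1]

theorem uUnstackable : UUnstackable (PhiHom Φ X unitInterval) := by
  intro r _ _ p q hp hq f g hpf hqf x
  have hpx : p.1 (f.toFun x) ≤ p.1 (g.toFun x) := hpf x
  have hqx : q.1 (f.toFun x) ≤ q.1 (g.toFun x) := hqf x
  change f.toFun x ≤ g.toFun x
  by_contra! hlt
  rcases lt_or_ge (g.toFun x) r with hr | hr
  · refine absurd hpx (not_le.2 ((hp.strictMonoOn ⟨unitInterval.nonneg', hr.le⟩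
      ⟨unitInterval.nonneg', min_le_right (f.toFun x) r⟩ (lt_min hlt hr)).trans_le ?_))
    exact p.1.monotone (min_le_left _ _)
  · exact absurd hqx (not_le.2 (hq.strictMonoOn ⟨hr, unitInterval.le_one'⟩
      ⟨hr.trans hlt.le, unitInterval.le_one'⟩ hlt))

/-- The homomorphism obtained by stacking `b` on top of `a`. -/
noncomputable def stack {r : unitInterval} {p q : UMon} (hp : RestrictsToIso p 0 r)
    (hq : RestrictsToIso q r 1) (a b : PhiHom Φ X unitInterval)
    (hab : ∀ x, 0 < b.toFun x → a.toFun x = 1) : PhiHom Φ X unitInterval :=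
  have hS : ∀ x, p.1 (sSup {t | p.1 t ≤ a.toFun x ∧ q.1 t ≤ b.toFun x}) ≤ a.toFun x ∧
      q.1 (sSup {t | p.1 t ≤ a.toFun x ∧ q.1 t ≤ b.toFun x}) ≤ b.toFun x := by
    intro x
    rw [UMon.map_sSup, UMon.map_sSup]
    constructor
    · apply sSup_le
      rintro _ ⟨t, ht, rfl⟩
      exact ht.1
    · apply sSup_le
      rintro _ ⟨t, ht, rfl⟩
      exact ht.2
  have hmono : Monotone fun x => sSup {t | p.1 t ≤ a.toFun x ∧ q.1 t ≤ b.toFun x} :=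
    fun x y hxy => sSup_le_sSup fun t ht => ⟨ht.1.trans (a.mono hxy), ht.2.trans (b.mono hxy)⟩
  { toFun := fun x => sSup {t | p.1 t ≤ a.toFun x ∧ q.1 t ≤ b.toFun x}
    map_sInf := fun s => by
      apply le_antisymm
      · apply le_sInf
        rintro _ ⟨x, hx, rfl⟩
        exact hmono (sInf_le hx)
      · apply le_sSup
        constructor
        · rw [a.map_sInf]
          apply le_sInf
          rintro _ ⟨x, hx, rfl⟩
          exact (p.1.monotone (sInf_le (Set.mem_image_of_mem _ hx))).trans (hS x).1
        · rw [b.map_sInf]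
          apply le_sInf
          rintro _ ⟨x, hx, rfl⟩
          exact (q.1.monotone (sInf_le (Set.mem_image_of_mem _ hx))).trans (hS x).2
    map_sSup := fun s hs => by
      apply le_antisymm
      · by_contra! hlt
        obtain ⟨t, ht1, ht2⟩ := exists_between hlt
        obtain ⟨h1, h2⟩ := hS (sSup s)
        suffices ∃ x ∈ s, p.1 t ≤ a.toFun x ∧ q.1 t ≤ b.toFun x by
          obtain ⟨x, hx, h⟩ := this
          refine absurd ((le_sSup (show t ∈ {t | p.1 t ≤ a.toFun x ∧ q.1 t ≤ b.toFun x}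
            from h)).trans ?_) (not_le.2 ht1)
          exact le_sSup (Set.mem_image_of_mem
            (fun x => sSup {t | p.1 t ≤ a.toFun x ∧ q.1 t ≤ b.toFun x}) hx)
        -- Only one constraint is active: for `t ≤ r` the map `q` vanishes at `t`, and for `t ≥ r`
        -- the chosen `x` has `b x > 0`, which forces `a x = 1`.
        rcases lt_or_ge t r with htr | htr
        · have h3 := (hp.strictMonoOn ⟨unitInterval.nonneg', htr.le⟩
            ⟨unitInterval.nonneg', min_le_right _ r⟩ (lt_min ht2 htr)).trans_le
              ((p.1.monotone (min_le_left _ _)).trans h1)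
          rw [a.map_sSup s hs] at h3
          obtain ⟨_, ⟨x, hx, rfl⟩, h4⟩ := lt_sSup_iff.1 h3
          exact ⟨x, hx, h4.le, ((q.1.monotone htr.le).trans hq.apply_left.le).trans
            unitInterval.nonneg'⟩
        · have h3 := (hq.strictMonoOn ⟨htr, unitInterval.le_one'⟩
            ⟨htr.trans ht2.le, unitInterval.le_one'⟩ ht2).trans_le h2
          rw [b.map_sSup s hs] at h3
          obtain ⟨_, ⟨x, hx, rfl⟩, h4⟩ := lt_sSup_iff.1 h3
          refine ⟨x, hx, ?_, h4.le⟩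
          rw [hab x (unitInterval.nonneg'.trans_lt h4)]
          exact unitInterval.le_one'
      · apply sSup_le
        rintro _ ⟨x, hx, rfl⟩
        exact hmono (le_sSup hx) }

theorem uStackable : UStackable (PhiHom Φ X unitInterval) := by
  refine ⟨uUnstackable, fun r hr0 hr1 p q hp hq a b hab => ?_⟩
  -- The hypothesis over all pairs in `𝕌` is used on ramps: if `b x > 0` and `a x < 1`, some pair
  -- sends `b x` to `1` and `a x` to `0`.
  have hab' : ∀ x, 0 < b.toFun x → a.toFun x = 1 := by
    intro x hx
    by_contra hne
    have hlt : a.toFun x < 1 := lt_of_le_of_ne unitInterval.le_one' hne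
    have h : (UMon.ramp 0 _ hx).1 (b.toFun x) ≤ (UMon.ramp _ 1 hlt).1 (a.toFun x) :=
      hab (UMon.ramp _ 1 hlt) (UMon.ramp 0 _ hx) x
    rw [UMon.ramp_of_le hlt le_rfl, UMon.ramp_of_ge hx le_rfl] at h
    exact absurd h (not_le.2 one_pos)
  refine ⟨stack hp hq a b hab', ?_, ?_⟩
  · apply PhiHom.ext
    funext x
    change p.1 (sSup {t | p.1 t ≤ a.toFun x ∧ q.1 t ≤ b.toFun x}) = a.toFun x
    apply le_antisymm
    · rw [UMon.map_sSup]
      apply sSup_le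
      rintro _ ⟨t, ht, rfl⟩
      exact ht.1
    · obtain ⟨t, ht, hpt⟩ := hp.surjOn (Set.mem_univ (a.toFun x))
      rw [← hpt]
      exact p.1.monotone (le_sSup ⟨le_rfl, ((q.1.monotone ht.2).trans hq.apply_left.le).trans
        unitInterval.nonneg'⟩)
  · apply PhiHom.ext
    funext x
    change q.1 (sSup {t | p.1 t ≤ a.toFun x ∧ q.1 t ≤ b.toFun x}) = b.toFun x
    apply le_antisymm
    · rw [UMon.map_sSup]
      apply sSup_le
      rintro _ ⟨t, ht, rfl⟩
      exact ht.2
    · obtain ⟨t, ht, hqt⟩ := hq.surjOn (Set.mem_univ (b.toFun x))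
      rcases eq_or_lt_of_le (unitInterval.nonneg' (t := b.toFun x)) with h0 | h0
      · exact h0 ▸ unitInterval.nonneg'
      · have hmem : p.1 t ≤ a.toFun x ∧ q.1 t ≤ b.toFun x :=
          ⟨hab' x h0 ▸ unitInterval.le_one', hqt.le⟩
        exact hqt.ge.trans (q.1.monotone (le_sSup hmem))

end PhiHom

theorem isCompleteStackable_latticeDual {Φ Ψ : JoinDoctrine.{u}}
    (h : JoinDoctrine.IsSoundDual Φ Ψ) (X : (PhiCtsLat Φ)ᵒᵖ) :
    isCompleteStackable Ψ ((latticeDual h).obj X) :=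
  ⟨PhiHom.uComplete, PhiHom.uStackable⟩

/-! ### Homomorphisms from an inflattice separate points -/

section Separation

variable {Ψ : JoinDoctrine.{u}}

/-- The homomorphism into `[0,1]` generated by the principal filter of `c`. -/
noncomputable def UInflattice.principalHom (A : UInflattice Ψ) (c : A.carrier) :
    UHom Ψ A.carrier unitInterval :=
  have hmono : Monotone fun a : A.carrier => sSup {r | ∃ p : UMon, p.1 r = 0 ∧ c ≤ p • a} :=
    fun a b hab => sSup_le_sSup fun _ ⟨p, hp, hc⟩ =>
      ⟨p, hp, hc.trans (UPoset.smul_le_smul p p a b le_rfl hab)⟩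
  { toFun := fun a => sSup {r | ∃ p : UMon, p.1 r = 0 ∧ c ≤ p • a}
    mono := hmono
    map_smul := fun q a => by
      apply le_antisymm
      · refine sSup_le fun r ⟨p, hp, hc⟩ => ?_
        obtain ⟨t, rfl⟩ := q.2 r
        exact q.1.monotone (le_sSup ⟨p * q, hp, by rwa [mul_smul]⟩)
      · change q.1 (sSup _) ≤ _
        rw [UMon.map_sSup]
        refine sSup_le ?_
        rintro _ ⟨r, ⟨p, hp, hc⟩, rfl⟩
        by_contra! hlt
        obtain ⟨s, hs1, hs2⟩ := exists_between hlt
        refine hs1.not_ge (le_sSup ⟨UMon.ramp s _ hs2, UMon.ramp_of_le hs2 le_rfl, ?_⟩)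
        have hle : p ≤ UMon.ramp s _ hs2 * q :=
          UMon.le_of_apply (m := r) hp (UMon.ramp_of_ge hs2 le_rfl)
        rw [← mul_smul]
        exact hc.trans (UPoset.smul_le_smul _ _ a a hle le_rfl)
    map_isGLB := fun s m hs hm => by
      refine ⟨?_, fun k hk => ?_⟩
      · rintro _ ⟨a, ha, rfl⟩
        exact hmono (hm.1 ha)
      · by_contra! hlt
        obtain ⟨r', hr1, hr2⟩ := exists_between hlt
        obtain ⟨r, hr3, hr4⟩ := exists_between hr1
        -- The numbers satisfy: value at `m` `< r < r' < k`. For each `a ∈ s` some `p` vanishing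
        -- beyond `r'` has `c ≤ p • a`, so the ramp from `r` to `r'` dominates `p`; since it
        -- preserves the meet, `r` would be at most the value at `m`.
        refine hr3.not_ge (le_sSup ⟨UMon.ramp r r' hr4, UMon.ramp_of_le hr4 le_rfl, ?_⟩)
        refine (A.smul_isGLB _ s m hs hm).2 ?_
        rintro _ ⟨a, ha, rfl⟩
        obtain ⟨t, ⟨p, hp, hc⟩, ht⟩ := lt_sSup_iff.1 (hr2.trans_le (hk ⟨a, ha, rfl⟩))
        refine hc.trans (UPoset.smul_le_smul _ _ a a (UMon.le_of_apply (m := r') ?_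
          (UMon.ramp_of_ge hr4 le_rfl)) le_rfl)
        exact le_antisymm ((p.1.monotone ht.le).trans hp.le) unitInterval.nonneg' }

/-- The principal homomorphism of `p • a` is at least `r` at `a`, hence exceeds `s` at `b`. So `p •
a ≤ p' • b` for some `p'` vanishing at `s`, and `p' ≤ q`. -/
theorem UInflattice.smul_le_smul_of_forall_le (A : UInflattice Ψ) {a b : A.carrier}
    (hab : ∀ f : UHom Ψ A.carrier unitInterval, f.toFun a ≤ f.toFun b) {p q : UMon}
    {s r : unitInterval} (hsr : s < r) (hp : p.1 r = 0) (hq : q.1 s = 1) : p • a ≤ q • b := by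
  have hr : r ≤ (A.principalHom (p • a)).toFun a := le_sSup ⟨p, hp, le_rfl⟩
  obtain ⟨t, ⟨p', hp', hc⟩, ht⟩ := lt_sSup_iff.1 (hsr.trans_le (hr.trans (hab _)))
  refine hc.trans (UPoset.smul_le_smul _ _ b b (UMon.le_of_apply (m := s) ?_ hq) le_rfl)
  exact le_antisymm ((p'.1.monotone ht.le).trans hp'.le) unitInterval.nonneg'

theorem UInflattice.le_of_forall_le (A : UInflattice Ψ) (hA : UArchimedean A.carrier)
    (hU : UUnstackable A.carrier) {a b : A.carrier}
    (hab : ∀ f : UHom Ψ A.carrier unitInterval, f.toFun a ≤ f.toFun b) : a ≤ b := by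
  refine hA a b fun r hr p q hpq => ?_
  have hr' : (0 : ℝ) < r := hr
  -- A grid of mesh `r / 2` starting at `r`, where `p` is still `0` because `p r ≤ q 0 = 0`. The
  -- claim advances along it through those `v` that have reached `1` by `p (τ n)`, and is vacuous at
  -- `n = 0`.
  let τ : ℕ → unitInterval := fun n => ⟨min 1 (r + n * (r / 2)), by positivity, min_le_left _ _⟩
  have hτ : ∀ n, (τ n : ℝ) = min 1 ((r : ℝ) + n * (r / 2)) := fun _ => rfl
  have claim : ∀ n (v : UMon), v.1 (p.1 (τ n)) = 1 → v • p • a ≤ v • q • b := by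
    intro n
    induction n with
    | zero =>
      intro v hv
      have h0 : p.1 (τ 0) ≤ 0 := by
        refine le_trans (p.1.monotone ?_) ((hpq 0).trans (UMon.map_zero q).le)
        change (τ 0 : ℝ) ≤ truncAdd 0 r
        rw [hτ, coe_truncAdd]
        simp
      rw [le_antisymm h0 unitInterval.nonneg', UMon.map_zero v] at hv
      exact absurd hv zero_ne_one
    | succ n ih =>
      have hr1 := r.2.2
      have hτn : (r : ℝ) ≤ τ n := by
        rw [hτ]
        exact le_min hr1 (le_add_of_nonneg_right (by positivity))
      have hτ1 := (τ n).2.2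
      -- Half of the lead `r` makes `s` strictly smaller than `τ n`; the other half still gives `p
      -- (τ (n + 1)) ≤ q s`.
      let s : unitInterval := ⟨τ n - r / 2, by linarith, by linarith⟩
      have hs : s < τ n := show (τ n : ℝ) - r / 2 < τ n by linarith
      have hqs : p.1 (τ (n + 1)) ≤ q.1 s := by
        refine le_trans (p.1.monotone ?_) (hpq s)
        change (τ (n + 1) : ℝ) ≤ truncAdd s r
        rw [coe_truncAdd, show (s : ℝ) + r = τ n + r / 2 by change (τ n : ℝ) - r / 2 + r = _; ring,
          hτ, hτ]
        refine le_min (min_le_left _ _) ?_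
        rcases min_choice 1 ((r : ℝ) + n * (r / 2)) with h | h <;> rw [h]
        · exact (min_le_left _ _).trans (by linarith)
        · exact (min_le_right _ _).trans (by push_cast; linarith)
      intro v hv
      have hvq : v.1 (q.1 s) = 1 :=
        le_antisymm unitInterval.le_one' (hv.ge.trans (v.1.monotone hqs))
      rcases eq_or_lt_of_le (unitInterval.nonneg' (t := v.1 (p.1 (τ n)))) with h0 | h0
      · simp only [← mul_smul]
        exact A.smul_le_smul_of_forall_le hab hs (p := v * p) (q := v * q) h0.symm hvq
      · rcases eq_or_lt_of_le (unitInterval.le_one' (t := v.1 (p.1 (τ n)))) with h1 | h1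
        · exact ih v h1
        -- Cut at `v (p (τ n))`: the lower part is the induction hypothesis, and on the upper part
        -- `p` is `0` at `τ n` while `q` is already `1` at `s`.
        · refine hU _ h0 h1 _ _ (UMon.ramp_restrictsToIso h0) (UMon.ramp_restrictsToIso h1) _ _ ?_ ?_
          · rw [← mul_smul, ← mul_smul _ v]
            exact ih _ (UMon.ramp_of_ge h0 le_rfl)
          · simp only [← mul_smul]
            refine A.smul_le_smul_of_forall_le hab hs (UMon.ramp_of_le h1 le_rfl) ?_
            change (UMon.ramp _ 1 h1).1 (v.1 (q.1 s)) = 1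
            rw [hvq, UMon.map_one]
  obtain ⟨n, hn⟩ := exists_nat_gt (1 / ((r : ℝ) / 2))
  have hτ1 : τ n = 1 := by
    apply Subtype.ext
    rw [hτ]
    rw [div_lt_iff₀ (by positivity)] at hn
    exact min_eq_left (by linarith)
  have := claim n 1 (by rw [hτ1, UMon.map_one p]; exact UMon.map_one 1)
  rwa [one_smul, one_smul] at this

end Separation

/-! ### Evaluation on a complete stackable inflattice is surjective -/

section InflatticeEval

variable {Φ Ψ : JoinDoctrine.{u}}

/-- Halving a ramp turns it into an average of two ramps. This both splits the target function and
computes the value of a stack cut at `1 / 2`. -/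
theorem UMon.coe_ramp_midpoint {a b m : unitInterval} (h : a < b) (ham : a < m) (hmb : m < b)
    (hm : (m : ℝ) = (a + b) / 2) (t : unitInterval) :
    ((ramp a b h).1 t : ℝ) = ((ramp a m ham).1 t + (ramp m b hmb).1 t) / 2 := by
  have hab : (0 : ℝ) < b - a := sub_pos.2 h
  have e1 : (m : ℝ) - a = (b - a) / 2 := by rw [hm]; ring
  have e2 : (b : ℝ) - m = (b - a) / 2 := by rw [hm]; ring
  rcases le_total t m with htm | htm
  · rw [ramp_of_le hmb htm]
    rcases le_total t a with hta | hta
    · rw [ramp_of_le h hta, ramp_of_le ham hta]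
      simp
    · rw [coe_ramp_of_mem h hta (htm.trans hmb.le), coe_ramp_of_mem ham hta htm, e1]
      simp only [Set.Icc.coe_zero]
      field_simp
      ring
  · rw [ramp_of_ge ham htm]
    rcases le_total b t with htb | htb
    · rw [ramp_of_ge h htb, ramp_of_ge hmb htb]
      simp
    · rw [coe_ramp_of_mem h (ham.le.trans htm) htb, coe_ramp_of_mem hmb htm htb, e2, hm]
      simp only [Set.Icc.coe_one]
      field_simp
      ring

variable (A : UInflattice Ψ)

/-- Evaluation at a point. -/
noncomputable def UInflattice.evalHom (h : JoinDoctrine.IsSoundDual Φ Ψ)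
    (a : A.carrier) :
    PhiHom Φ (UHom Ψ A.carrier unitInterval) unitInterval :=
  (show UHom Ψ A.carrier (PhiHom Φ (UHom Ψ A.carrier unitInterval) unitInterval) from
    inflatticeEval h A).toFun a

theorem UInflattice.evalHom_apply (h : JoinDoctrine.IsSoundDual Φ Ψ)
    (a : A.carrier) (g : UHom Ψ A.carrier unitInterval) :
    (A.evalHom h a).toFun g = g.toFun a := rfl

/-- The element `(A.evalHom h a).leftAdj 1` is the least homomorphism with value `1` at `a`. Over
all `a` with `f a = 1` these have a `Φ`-join above `f`, as rescaling `c` by a ramp so that `f` takes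
value `1` shows. -/
theorem UInflattice.exists_wayBelow_evalHom (h : JoinDoctrine.IsSoundDual Φ Ψ)
    {f g : UHom Ψ A.carrier unitInterval}
    (hg : PhiWayBelow Φ g f) : ∃ a, f.toFun a = 1 ∧ g ≤ (A.evalHom h a).leftAdj 1 := by
  let e : A.carrierᵒᵈ → UHom Ψ A.carrier unitInterval :=
    fun a => (A.evalHom h (OrderDual.ofDual a)).leftAdj 1
  have he : Monotone e := fun a b hab => (PhiHom.leftAdj_le_iff _).2
    (((PhiHom.leftAdj_le_iff _).1 (le_refl (e b))).trans (UHom.mono (e b) hab))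
  obtain ⟨_, ⟨a, ha, rfl⟩, hga⟩ := hg.exists_le
    (Φ.mem_image he (UInflattice.preimage_one_mem h A f)) (fun c => by
      change f.toFun c ≤ (sSup _ : UHom Ψ A.carrier unitInterval).toFun c
      rcases eq_or_lt_of_le (unitInterval.nonneg' (t := f.toFun c)) with h0 | h0
      · exact h0 ▸ unitInterval.nonneg'
      · let b := UMon.ramp 0 _ h0 • c
        have hb : f.toFun b = 1 := (f.map_smul _ c).trans (UMon.ramp_of_ge h0 le_rfl)
        refine le_trans ?_ ((show e (OrderDual.toDual b) ≤ _ from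
          le_sSup (Set.mem_image_of_mem e hb)) c)
        apply UMon.le_of_ramp_eq_one h0
        have h1 : 1 ≤ (e (OrderDual.toDual b)).toFun b :=
          (PhiHom.leftAdj_le_iff (A.evalHom h b)).1 le_rfl
        exact ((UHom.map_smul _ _ c).symm.trans (le_antisymm unitInterval.le_one' h1)))
  exact ⟨OrderDual.ofDual a, ha, hga⟩

variable {A}

theorem UInflattice.exists_indicator (h : JoinDoctrine.IsSoundDual Φ Ψ)
    (hω : Φ.HasOmega)
    (G : PhiHom Φ (UHom Ψ A.carrier unitInterval) unitInterval) {r s : unitInterval} (hrs : r < s) :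
    ∃ a : A.carrier, (∀ g : UHom Ψ A.carrier unitInterval, 0 < g.toFun a → r ≤ G.toFun g) ∧
      ∀ g, s ≤ G.toFun g → g.toFun a = 1 := by
  -- Two `≪`-steps are spent: from `s` to `m` to find `a`, and from `m` to `r` to relax the
  -- threshold `1` to some `t < 1`, which leaves room for a ramp.
  obtain ⟨m, hrm, hms⟩ := exists_between hrs
  obtain ⟨a, ha, hma⟩ := A.exists_wayBelow_evalHom h (G.leftAdj_wayBelow hms)
  obtain ⟨t, ht1, ht⟩ := PhiHom.exists_lt_one_of_wayBelow hω _
    ((G.leftAdj_wayBelow hrm).mono le_rfl hma)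
  refine ⟨UMon.ramp t 1 ht1 • a, fun g hg => ?_, fun g hg => ?_⟩
  · rw [g.map_smul] at hg
    refine G.leftAdj_le_iff.1 (ht.trans ((PhiHom.leftAdj_le_iff _).2 ?_))
    rw [UInflattice.evalHom_apply]
    by_contra! hlt
    exact absurd hg (not_lt.2 (UMon.ramp_of_le ht1 hlt.le).le)
  · rw [g.map_smul]
    refine UMon.ramp_of_ge ht1 (ha.ge.trans ?_)
    exact (show G.leftAdj s ≤ g from G.leftAdj_le_iff.2 hg) a

/-- Halve `[r, s]` and stack the approximants of the two halves. The first two conjuncts carry the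
induction: `g c₂ > 0` forces `m ≤ G g`, hence `g c₁ = 1`, which is the compatibility stacking
requires. -/
theorem UInflattice.exists_approx (h : JoinDoctrine.IsSoundDual Φ Ψ)
    (hω : Φ.HasOmega) (hA : UArchimedean A.carrier)
    (hS : UStackable A.carrier) (G : PhiHom Φ (UHom Ψ A.carrier unitInterval) unitInterval)
    (k : ℕ) {r s : unitInterval} (hrs : r < s) :
    ∃ c : A.carrier, (∀ g : UHom Ψ A.carrier unitInterval, 0 < g.toFun c → r ≤ G.toFun g) ∧
      (∀ g, s ≤ G.toFun g → g.toFun c = 1) ∧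
        ∀ g, |(g.toFun c : ℝ) - (UMon.ramp r s hrs).1 (G.toFun g)| ≤ (1 / 2) ^ k := by
  induction k generalizing r s with
  | zero =>
    obtain ⟨c, h1, h2⟩ := UInflattice.exists_indicator h hω G hrs
    refine ⟨c, h1, h2, fun g => ?_⟩
    rw [pow_zero]
    exact abs_sub_le_of_nonneg_of_le (g.toFun c).2.1 (g.toFun c).2.2
      ((UMon.ramp r s hrs).1 (G.toFun g)).2.1 ((UMon.ramp r s hrs).1 (G.toFun g)).2.2
  | succ k ih =>
    have hrs' : (r : ℝ) < s := hrs
    have hr0 := r.2.1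
    have hs1 := s.2.2
    let m : unitInterval := ⟨((r : ℝ) + s) / 2, by linarith, by linarith⟩
    have hrm : r < m := show (r : ℝ) < (r + s) / 2 by linarith
    have hms : m < s := show ((r : ℝ) + s) / 2 < s by linarith
    obtain ⟨c₁, hc₁, hc₁', hd₁⟩ := ih hrm
    obtain ⟨c₂, hc₂, hc₂', hd₂⟩ := ih hms
    let half : unitInterval := ⟨1 / 2, by norm_num, by norm_num⟩
    have h0 : 0 < half := show (0 : ℝ) < 1 / 2 by norm_num
    have h1 : half < 1 := show (1 / 2 : ℝ) < 1 by norm_num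
    obtain ⟨c, hca, hcb⟩ := hS.2 half h0 h1 _ _ (UMon.ramp_restrictsToIso h0)
      (UMon.ramp_restrictsToIso h1) c₁ c₂ (fun p q => by
        refine A.le_of_forall_le hA hS.1 fun f => ?_
        rw [f.map_smul, f.map_smul]
        change q.1 (f.toFun c₂) ≤ p.1 (f.toFun c₁)
        rcases eq_or_lt_of_le (unitInterval.nonneg' (t := f.toFun c₂)) with h0 | h0
        · rw [← h0, UMon.map_zero q]
          exact unitInterval.nonneg'
        · rw [hc₁' f (hc₂ f h0), UMon.map_one p]
          exact unitInterval.le_one')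
    have hga : ∀ g : UHom Ψ A.carrier unitInterval,
        (UMon.ramp 0 half h0).1 (g.toFun c) = g.toFun c₁ := fun g => by
      rw [← hca, g.map_smul]; rfl
    have hgb : ∀ g : UHom Ψ A.carrier unitInterval,
        (UMon.ramp half 1 h1).1 (g.toFun c) = g.toFun c₂ := fun g => by
      rw [← hcb, g.map_smul]; rfl
    refine ⟨c, fun g hg => hc₁ g ?_, fun g hg => ?_, fun g => ?_⟩
    · rw [← hga]
      exact UMon.ramp_pos h0 hg
    · exact le_antisymm unitInterval.le_one' (UMon.le_of_ramp_eq_one h1 (by rw [hgb, hc₂' g hg]))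
    · have hgc : (g.toFun c : ℝ) = (g.toFun c₁ + g.toFun c₂) / 2 := by
        rw [← hga, ← hgb, ← UMon.coe_ramp_midpoint (h0.trans h1) h0 h1 (by simp [half]),
          UMon.coe_ramp_of_mem _ unitInterval.nonneg' unitInterval.le_one']
        simp
      rw [hgc, UMon.coe_ramp_midpoint hrs hrm hms rfl, pow_succ, ← sub_div, abs_div,
        abs_of_pos (two_pos (α := ℝ)), div_eq_mul_one_div]
      refine mul_le_mul_of_nonneg_right ?_ (by norm_num)
      -- Only one half contributes an error for a given `g`, the other being exact; the averaging
      -- then halves that error.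
      rcases lt_or_ge (G.toFun g) m with hG | hG
      · have e : g.toFun c₂ = 0 := by
          by_contra hne
          exact absurd (hc₂ g (lt_of_le_of_ne unitInterval.nonneg' (Ne.symm hne))) (not_le.2 hG)
        rw [e, UMon.ramp_of_le hms hG.le]
        simpa using hd₁ g
      · rw [hc₁' g hG, UMon.ramp_of_ge hrm hG, add_sub_add_left_eq_sub]
        exact hd₂ g

theorem UInflattice.leUpTo_of_forall (hA : UArchimedean A.carrier) (hU : UUnstackable A.carrier)
    {r : unitInterval} {a b : A.carrier}
    (hab : ∀ g : UHom Ψ A.carrier unitInterval, (g.toFun a : ℝ) ≤ g.toFun b + r) :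
    LeUpTo r a b := fun p q hpq => by
  refine A.le_of_forall_le hA hU fun g => ?_
  rw [g.map_smul, g.map_smul]
  exact leUpTo_iff.2 (hab g) p q hpq

theorem UInflattice.exists_eval_eq (h : JoinDoctrine.IsSoundDual Φ Ψ)
    (hω : Φ.HasOmega) (hA : UComplete A.carrier)
    (hS : UStackable A.carrier) (G : PhiHom Φ (UHom Ψ A.carrier unitInterval) unitInterval) :
    ∃ a : A.carrier, ∀ g, G.toFun g = g.toFun a := by
  -- With `r = 0` and `s = 1` the ramp is the identity, so `c k` approximates `G` itself.
  choose c _ _ hc using fun k => UInflattice.exists_approx h hω hA.1 hS G k (zero_lt_one)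
  have hcG : ∀ k (g : UHom Ψ A.carrier unitInterval),
      |(g.toFun (c k) : ℝ) - G.toFun g| ≤ (1 / 2) ^ k := by
    intro k g
    have := hc k g
    rw [UMon.coe_ramp_of_mem _ unitInterval.nonneg' unitInterval.le_one'] at this
    simpa using this
  have hpow : ∀ ε : ℝ, 0 < ε → ∃ N, ∀ n ≥ N, ((1 : ℝ) / 2) ^ n < ε := by
    intro ε hε
    obtain ⟨N, hN⟩ := exists_pow_lt_of_lt_one hε (one_half_lt_one (α := ℝ))
    exact ⟨N, fun n hn => (pow_le_pow_of_le_one (by norm_num) (by norm_num) hn).trans_lt hN⟩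
  obtain ⟨a, ha⟩ := hA.2 c fun ε hε => by
    obtain ⟨δ, hδ0, hδ⟩ := exists_between hε
    have hδ0' : (0 : ℝ) < δ := hδ0
    obtain ⟨N, hN⟩ := hpow (δ / 2) (by positivity)
    have key : ∀ m ≥ N, ∀ n ≥ N, uRho (c m) (c n) ≤ δ := fun m hm n hn =>
      uRho_le (UInflattice.leUpTo_of_forall hA.1 hS.1 fun g => by
        have h1 := abs_le.1 ((hcG m g).trans (hN m hm).le)
        have h2 := abs_le.1 ((hcG n g).trans (hN n hn).le)
        linarith [h1.2, h2.1])
    exact ⟨N, fun m hm n hn => (sup_le (key m hm n hn) (key n hn m hm)).trans_lt hδ⟩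
  refine ⟨a, fun g => eq_of_forall_dist_le fun ε hε => ?_⟩
  obtain ⟨N, hN⟩ := hpow (ε / 2) (by positivity)
  obtain ⟨M, hM⟩ := ha ⟨min 1 (ε / 2), by positivity, min_le_left _ _⟩
    (show (0 : ℝ) < min 1 (ε / 2) by positivity)
  have hd := hM (max M N) (le_max_left _ _)
  have h1 := abs_le.1 ((hcG _ g).trans (hN (max M N) (le_max_right _ _)).le)
  have h2 : (g.toFun (c (max M N)) : ℝ) ≤ g.toFun a + min 1 (ε / 2) :=
    leUpTo_iff.1 (g.leUpTo (leUpTo_of_uRho_lt (le_sup_left.trans_lt hd)))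
  have h3 : (g.toFun a : ℝ) ≤ g.toFun (c (max M N)) + min 1 (ε / 2) :=
    leUpTo_iff.1 (g.leUpTo (leUpTo_of_uRho_lt (le_sup_right.trans_lt hd)))
  have h4 := min_le_right (1 : ℝ) (ε / 2)
  rw [Subtype.dist_eq, Real.dist_eq]
  exact abs_le.2 ⟨by linarith [h1.1], by linarith [h1.2]⟩

end InflatticeEval

/-! ### The duality -/

section Isomorphisms

variable {Φ Ψ : JoinDoctrine.{u}}

theorem UInflattice.isIso_of_surjective {A B : UInflattice Ψ} (f : UHom Ψ A.carrier B.carrier)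
    (hle : ∀ a b, f.toFun a ≤ f.toFun b → a ≤ b) (hf : Function.Surjective f.toFun) :
    IsIso (show A ⟶ B from f) := by
  choose g hg using hf
  have hgf : ∀ a, g (f.toFun a) = a := fun a =>
    le_antisymm (hle _ _ (hg _).le) (hle _ _ (hg _).ge)
  have hmono : Monotone g := fun a b hab => hle _ _ (by rwa [hg, hg])
  let g' : UHom Ψ B.carrier A.carrier :=
    { toFun := g
      mono := hmono
      map_smul := fun p b => by
        rw [← hgf (p • g b), f.map_smul, hg]
      map_isGLB := fun s m _ hm => by
        refine ⟨?_, fun k hk => ?_⟩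
        · rintro _ ⟨b, hb, rfl⟩
          exact hmono (hm.1 hb)
        · refine hle _ _ ?_
          rw [hg]
          exact hm.2 fun b hb => hg b ▸ f.mono (hk ⟨b, hb, rfl⟩) }
  exact ⟨show B ⟶ A from g', UHom.ext (funext hgf), UHom.ext (funext hg)⟩

theorem PhiCtsLat.isIso_of_surjective {X Y : PhiCtsLat Φ} (f : PhiHom Φ X.carrier Y.carrier)
    (hle : ∀ a b, f.toFun a ≤ f.toFun b → a ≤ b) (hf : Function.Surjective f.toFun) :
    IsIso (show X ⟶ Y from f) := by
  choose g hg using hf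
  have hgf : ∀ a, g (f.toFun a) = a := fun a =>
    le_antisymm (hle _ _ (hg _).le) (hle _ _ (hg _).ge)
  let e : Y.carrier ≃o X.carrier :=
    { toFun := g
      invFun := f.toFun
      left_inv := hg
      right_inv := hgf
      map_rel_iff' := fun {a b} => ⟨fun h => by simpa [hg] using f.mono h,
        fun h => hle _ _ (by simpa [hg] using h)⟩ }
  let g' : PhiHom Φ Y.carrier X.carrier :=
    { toFun := g
      map_sInf := fun s => (map_sInf e s)
      map_sSup := fun s _ => (map_sSup e s) }
  exact ⟨show Y ⟶ X from g', PhiHom.ext (funext hgf), PhiHom.ext (funext hg)⟩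

theorem isIso_latticeEval (h : JoinDoctrine.IsSoundDual Φ Ψ) (hω : Φ.HasOmega)
    (X : PhiCtsLat Φ) : IsIso (latticeEval h X) :=
  PhiCtsLat.isIso_of_surjective (Y := (X.dual h.commute).dual h) (latticeEval h X)
    (fun _ _ hab => PhiHom.le_of_forall_apply_le X.continuous hab) fun F => by
      obtain ⟨x, hx⟩ := PhiHom.exists_eval_eq h hω X F
      exact ⟨x, UHom.ext (funext fun g => (hx g).symm)⟩

theorem isIso_inflatticeEval (h : JoinDoctrine.IsSoundDual Φ Ψ) (hω : Φ.HasOmega)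
    (A : UInflattice Ψ) (hA : isCompleteStackable Ψ A) : IsIso (inflatticeEval h A) :=
  UInflattice.isIso_of_surjective (B := (A.dual h).dual h.commute) (inflatticeEval h A)
    (fun _ _ hab => A.le_of_forall_le hA.1.1 hA.2.1 hab) fun G => by
      obtain ⟨a, ha⟩ := UInflattice.exists_eval_eq h hω hA.1 hA.2 G
      exact ⟨a, PhiHom.ext (funext fun g => (ha g).symm)⟩

end Isomorphisms

theorem mainTheorem3 (Φ Ψ : JoinDoctrine.{u}) (h : JoinDoctrine.IsSoundDual Φ Ψ)
    (hω : Φ.HasOmega) :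
    ∃ hC : ∀ X, isCompleteStackable Ψ ((latticeDual h).obj X),
      (latticeDualCSt h hC).IsEquivalence ∧ (inflatticeDualCSt h).IsEquivalence ∧
        IsIso (dualAdjunctionCSt h hC).unit ∧ IsIso (dualAdjunctionCSt h hC).counit := by
  have hC := isCompleteStackable_latticeDual h
  have hunit : ∀ A, IsIso ((dualAdjunctionCSt h hC).unit.app A) := fun A => by
    have : IsIso ((isCompleteStackable Ψ).ι.map ((dualAdjunctionCSt h hC).unit.app A)) :=
      isIso_inflatticeEval h hω A.obj A.property
    exact isIso_of_reflects_iso _ (isCompleteStackable Ψ).ι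
  have hcounit : ∀ X, IsIso ((dualAdjunctionCSt h hC).counit.app X) := fun X => by
    have := isIso_latticeEval h hω X.unop
    exact (inferInstance : IsIso (latticeEval h X.unop).op)
  exact ⟨hC, (dualAdjunctionCSt h hC).toEquivalence.isEquivalence_inverse,
    (dualAdjunctionCSt h hC).toEquivalence.isEquivalence_functor,
    NatIso.isIso_of_isIso_app _, NatIso.isIso_of_isIso_app _⟩
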